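/- Let $\mathcal{C}$ be an abelian category with enough projectives and let $A$ be an object of $\mathcal{C}$. Choose for every object $B$ a projective resolution $(B_\bullet,b_\bullet)$ with syzygies $\widetilde{B}_0=B$ and $\widetilde{B}_{k+1}=\ker(B_k\to\widetilde{B}_k)$, so that there are short exact sequences $0\to\widetilde{B}_{k+1}\to B_k\to\widetilde{B}_k\to0$. For every morphism $f:B\to B'$ choose a chain map $f_\bullet:B_\bullet\to B'_\bullet$ lifting $f$ with induced morphisms $\widetilde{f}_k:\widetilde{B}_k\to\widetilde{B}'_k$. For every short exact sequence $0\to B\to C\to D\to0$ choose, by the Horseshoe Lemma, a short exact sequence $0\to B_\bullet\to C_\bullet\to D_\bullet\to0$ of projective resolutions, where $C_\bullet$ is some resolution of $C$; it induces short exact sequences $0\to\widetilde{B}_k\to\widetilde{C}_k\to\widetilde{D}_k\to0$. A morphism $h^*$ is said to lift the identity along two short exact sequences with the same right-hand term and with the middle term of the first one projective if it is the left-hand component of a morphism from the first to the second sequence that is the identity on the right. Write $[X,Y]$ for the group of morphisms $X\to Y$ modulo those that factor through a projective object. Consider the following three constructions ($n\in\mathbb{Z}$; direct limits run over all $k\ge0$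 with $n+k\ge0$). * The resolution construction $\mathrm{Ext}^n_{Res}(A,B)=\varinjlim_k\mathrm{Ext}^{n+k}(A,\widetilde{B}_k)$, with the connecting homomorphisms of $0\to\widetilde{B}_{k+1}\to B_k\to\widetilde{B}_k\to0$ as transition maps, with the homomorphisms induced by $\widetilde{f}_k$, and with $\widetilde{\delta}^n=\varinjlim_k(-1)^k\delta^{n+k}$, where $\delta^{n+k}$ is the connecting homomorphism of $0\to\widetilde{B}_k\to\widetilde{C}_k\to\widetilde{D}_k\to0$. * The hypercohomology construction $\widehat{\mathcal{E}xt}^n(A,B)$: families $\varphi=(\varphi_{n+k}:A_{n+k}\to B_k)_k$ for which all but finitely many of the differences $b_{k+1}\varphi_{n+k+1}-(-1)^n\varphi_{n+k}a_{n+k+1}$ vanish (almost chain maps $A[n]_\bullet\to B_\bullet$), modulo the families $\varphi$ for which there is a family $e=(e_{n-1+k}:A_{n-1+k}\to B_k)_k$ such that $\varphi_{n+k}=b_{k+1}e_{n+k}-(-1)^{n-1}e_{n-1+k}a_{n+k}$ for all but finitely many $k$. A morphism $f$ induces $\varphi\mapsto f_\bullet\circ\varphi$. The connecting homomorphism $\widehat{\Delta}^n$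 of $0\to B\to C\to D\to0$ sends the class of $\varphi$ to the class of $\big((-1)^{k+n}h_k\circ\varphi_{n+k+1}:A_{n+1+k}\to B_k\big)_k$, where $h_\bullet:D_{\bullet+1}\to B_\bullet$ is a chosen chain map lifting a chosen morphism $h^*:\widetilde{D}_1\to B$ that lifts the identity along $0\to\widetilde{D}_1\to D_0\to D\to0$ and $0\to B\to C\to D\to0$. * The naïve construction $BC^n(A,B)=\varinjlim_k[\widetilde{A}_{n+k},\widetilde{B}_k]$, where the transition map $t$ sends the class of $g:\widetilde{A}_p\to\widetilde{B}_q$ to the class of any morphism $\widetilde{A}_{p+1}\to\widetilde{B}_{q+1}$ induced by a lift $A_p\to B_q$ of $g$, with the homomorphisms induced by $\widetilde{f}_k$, and with $\tau^n=\varinjlim_k(-1)^k[\widetilde{A}_{n+k+1},h^*_k]\circ t$, where $h^*_k:\widetilde{D}_{k+1}\to\widetilde{B}_k$ lifts the identity along $0\to\widetilde{D}_{k+1}\to D_k\to\widetilde{D}_k\to0$ and $0\to\widetilde{B}_k\to\widetilde{C}_k\to\widetilde{D}_k\to0$. Let $\sigma^n:\mathrm{Ext}^n_{Res}(A,B)\to\widehat{\mathcal{E}xt}^n(A,B)$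 be the homomorphism that sends, for every even $k$, the class of a cocycle $A_{n+k}\to\widetilde{B}_k$ to the class of any chain map $A[n+k]_\bullet\to B_{\bullet+k}$ lifting it, extended by zero to an almost chain map. Let $\beta^n:\mathrm{Ext}^n_{Res}(A,B)\to BC^n(A,B)$ be the homomorphism that sends the class of a cocycle $f:A_{n+k}\to\widetilde{B}_k$ to the class of the morphism $f':\widetilde{A}_{n+k}\to\widetilde{B}_k$ through which $f$ factors. Let $\rho^n:\widehat{\mathcal{E}xt}^n(A,B)\to BC^n(A,B)$ be the map of Guo and Liang: for the class of an almost chain map $\varphi$ choose $K$ with $n+2K\ge0$ such that $(\varphi_{n+k})_{k\ge2K}$ is a chain map; then $\rho^n$ sends this class to the image in the direct limit of the class in $[\widetilde{A}_{n+2K},\widetilde{B}_{2K}]$ of the induced morphism $\widetilde{A}_{n+2K}\to\widetilde{B}_{2K}$ of syzygies. (All these maps are well defined.) Then $(\mathrm{Ext}^\bullet_{Res}(A,-),\widetilde{\delta}^\bullet)$, $(\widehat{\mathcal{E}xt}^\bullet(A,-),\widehat{\Delta}^\bullet)$ and $(BC^\bullet(A,-),\tau^\bullet)$ are cohomological functors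 from $\mathcal{C}$ to abelian groups: families, indexed by $n\in\mathbb{Z}$, of additive functors with natural connecting homomorphisms and long exact sequences. The families $\sigma^\bullet$, $\beta^\bullet$ and $$\rho^\bullet:(\widehat{\mathcal{E}xt}^\bullet(A,-),\widehat{\Delta}^\bullet)\to(BC^\bullet(A,-),\tau^\bullet)$$ are isomorphisms of cohomological functors, that is, natural isomorphisms that commute with the connecting homomorphisms, and $$\rho^n=\beta^n\circ(\sigma^n)^{-1}\qquad\text{for all }n\in\mathbb{Z}.$$ -/

import Mathlib

open CategoryTheory CategoryTheory.Limits
open scoped DirectSum ZeroObject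

universe v u

namespace CompleteExt

section

section Graph

variable {G : Type*} {H : Type*} [AddCommGroup G] [AddCommGroup H]

/-- The homomorphism whose graph is the subgroup `Γ`. -/
noncomputable def homOfGraph (Γ : AddSubgroup (G × H)) (total : ∀ g, ∃ h, (g, h) ∈ Γ)
    (single : ∀ h, ((0 : G), h) ∈ Γ → h = 0) : G →+ H :=
  AddMonoidHom.mk' (fun g => (total g).choose) (fun a b => by
    have h := Γ.sub_mem (total (a + b)).choose_spec
      (Γ.add_mem (total a).choose_spec (total b).choose_spec)
    simp only [Prod.mk_add_mk, Prod.mk_sub_mk, sub_self] at h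
    exact sub_eq_zero.1 (single _ h))

theorem homOfGraph_eq {Γ : AddSubgroup (G × H)} {total : ∀ g, ∃ h, (g, h) ∈ Γ}
    {single : ∀ h, ((0 : G), h) ∈ Γ → h = 0} {g : G} {h : H} (hgh : (g, h) ∈ Γ) :
    homOfGraph Γ total single g = h := by
  have h' := Γ.sub_mem (total g).choose_spec hgh
  simp only [Prod.mk_sub_mk, sub_self] at h'
  exact sub_eq_zero.1 (single _ h')

end Graph

section DirectLimit

variable {I : Type} (s : I → I) (G : I → Type v) [∀ i, AddCommGroup (G i)]
  (t : ∀ i, G i →+ G (s i))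

open Classical in
/-- The direct limit of the direct system of abelian groups with terms `G i` and transition
homomorphisms `t i : G i →+ G (s i)`, as the quotient of the direct sum by the relations
`x ∼ t i x`. -/
def DirLim : Type v :=
  (⨁ i, G i) ⧸ AddSubgroup.closure
    {y | ∃ (i : I) (x : G i), y = DirectSum.of G i x - DirectSum.of G (s i) (t i x)}

noncomputable instance : AddCommGroup (DirLim s G t) :=
  inferInstanceAs (AddCommGroup (_ ⧸ _))

namespace DirLim

variable {s G t}

open Classical in
/-- The canonical homomorphism into the direct limit. -/
noncomputable def of (i : I) : G i →+ DirLim s G t :=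
  (QuotientAddGroup.mk' _).comp (DirectSum.of G i)

theorem of_trans (i : I) (x : G i) :
    (of (s i) (t i x) : DirLim s G t) = of i x := by
  classical
  refine (QuotientAddGroup.eq_iff_sub_mem.2 ?_).symm
  exact AddSubgroup.subset_closure ⟨i, x, by congr!⟩

open Classical in
/-- The homomorphism out of the direct limit induced by a compatible family. -/
noncomputable def lift {H : Type*} [AddCommGroup H] (f : ∀ i, G i →+ H)
    (hf : ∀ i x, f (s i) (t i x) = f i x) : DirLim s G t →+ H :=
  QuotientAddGroup.lift _ (DirectSum.toAddMonoid f) (by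
    rw [AddSubgroup.closure_le]
    rintro _ ⟨i, x, rfl⟩
    simp [hf])

theorem lift_of {H : Type*} [AddCommGroup H] (f : ∀ i, G i →+ H)
    (hf : ∀ i x, f (s i) (t i x) = f i x) (i : I) (x : G i) :
    lift f hf (of i x) = f i x := by
  classical
  change DirectSum.toAddMonoid f (DirectSum.of G i x) = _
  convert DirectSum.toAddMonoid_of f i x

theorem hom_ext {H : Type*} [AddCommGroup H] {f g : DirLim s G t →+ H}
    (h : ∀ i x, f (of i x) = g (of i x)) : f = g := by
  classical
  refine QuotientAddGroup.addMonoidHom_ext _ (DirectSum.addHom_ext fun i y => ?_)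
  convert h i y <;> congr!

end DirLim

end DirectLimit

section Stable

variable {C : Type u} [Category.{v} C] [Abelian C]

/-- The morphisms `X ⟶ Y` factoring through a projective object. -/
def projHom (X Y : C) : AddSubgroup (X ⟶ Y) where
  carrier := {f | ∃ (Q : C) (_ : Projective Q) (a : X ⟶ Q) (b : Q ⟶ Y), a ≫ b = f}
  zero_mem' := ⟨0, inferInstance, 0, 0, by simp⟩
  add_mem' := by
    rintro _ _ ⟨Q, _, a, b, rfl⟩ ⟨Q', _, a', b', rfl⟩
    exact ⟨Q ⊞ Q', inferInstance, biprod.lift a a', biprod.desc b b', by simp⟩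
  neg_mem' := by
    rintro _ ⟨Q, hQ, a, b, rfl⟩
    exact ⟨Q, hQ, -a, b, by simp⟩

/-- The group `[X, Y]` of morphisms modulo the ones factoring through a projective object. -/
abbrev Stable (X Y : C) : Type v := (X ⟶ Y) ⧸ projHom X Y

/-- The class of a morphism in `[X, Y]`. -/
abbrev Stable.mk {X Y : C} (f : X ⟶ Y) : Stable X Y := QuotientAddGroup.mk f

theorem Stable.mk_eq_zero {X Y : C} {f : X ⟶ Y} : Stable.mk f = 0 ↔ f ∈ projHom X Y :=
  QuotientAddGroup.eq_zero_iff f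

/-- The homomorphism `[X, g]` from `[X, Y]` to `[X, Z]`. -/
def Stable.post (X : C) {Y Z : C} (g : Y ⟶ Z) : Stable X Y →+ Stable X Z :=
  QuotientAddGroup.map _ _ (Preadditive.rightComp X g) (by
    rintro _ ⟨Q, hQ, a, b, rfl⟩
    exact ⟨Q, hQ, a, b ≫ g, by simp [Preadditive.rightComp]⟩)

theorem Stable.post_mk {X Y Z : C} (f : X ⟶ Y) (g : Y ⟶ Z) :
    Stable.post X g (Stable.mk f) = Stable.mk (f ≫ g) := rfl

end Stable

section Resolution

variable {C : Type u} [Category.{v} C] [Abelian C]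

variable (C) in
/-- A projective resolution cut into the short exact sequences
`0 ⟶ X (k + 1) ⟶ Q k ⟶ X k ⟶ 0` of its syzygies: it resolves `X 0`, its terms are the
projective objects `Q k`, its `k`-th syzygy is `X k`. -/
structure CutResolution where
  X : ℕ → C
  Q : ℕ → C
  ι : ∀ k, X (k + 1) ⟶ Q k
  π : ∀ k, Q k ⟶ X k
  w : ∀ k, ι k ≫ π k = 0
  exact : ∀ k, (ShortComplex.mk (ι k) (π k) (w k)).ShortExact
  proj : ∀ k, Projective (Q k)

namespace CutResolution

attribute [instance] CutResolution.proj

variable (K L : CutResolution C)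

instance (k : ℕ) : Mono (K.ι k) := (K.exact k).mono_f
instance (k : ℕ) : Epi (K.π k) := (K.exact k).epi_g

/-- The short exact sequence `0 ⟶ X (k + 1) ⟶ Q k ⟶ X k ⟶ 0`. -/
abbrev ses (k : ℕ) : ShortComplex C := ShortComplex.mk (K.ι k) (K.π k) (K.w k)

/-- The differential of the resolution. -/
def d (k : ℕ) : K.Q (k + 1) ⟶ K.Q k := K.π (k + 1) ≫ K.ι k

theorem w_assoc (k : ℕ) {Z : C} (h : K.X k ⟶ Z) : K.ι k ≫ K.π k ≫ h = 0 ≫ h := by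
  rw [← Category.assoc, w]

theorem d_π (k : ℕ) : K.d k ≫ K.π k = 0 := by simp [d, w]

theorem d_π_assoc (k : ℕ) {Z : C} (h : K.X k ⟶ Z) : K.d k ≫ K.π k ≫ h = 0 ≫ h := by
  rw [← Category.assoc, d_π]

theorem ι_d (k : ℕ) : K.ι (k + 1) ≫ K.d k = 0 := by simp [d, w_assoc]

theorem d_d (k : ℕ) : K.d (k + 1) ≫ K.d k = 0 := by
  rw [d, Category.assoc, ι_d, comp_zero]

theorem d_d_assoc (k : ℕ) {Z : C} (h : K.Q k ⟶ Z) : K.d (k + 1) ≫ K.d k ≫ h = 0 ≫ h := by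
  rw [← Category.assoc, d_d]

theorem exists_lift {Y : C} [Projective Y] {k : ℕ} (f : Y ⟶ K.X k) :
    ∃ g : Y ⟶ K.Q k, g ≫ K.π k = f :=
  ⟨Projective.factorThru f (K.π k), Projective.factorThru_comp _ _⟩

theorem exists_ker {Y : C} {k : ℕ} (f : Y ⟶ K.Q k) (hf : f ≫ K.π k = 0) :
    ∃ g : Y ⟶ K.X (k + 1), g ≫ K.ι k = f :=
  ⟨(K.exact k).exact.lift f hf, (K.exact k).exact.lift_f f hf⟩

theorem exists_d {Y : C} [Projective Y] {k : ℕ} (f : Y ⟶ K.Q k) (hf : f ≫ K.π k = 0) :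
    ∃ g : Y ⟶ K.Q (k + 1), g ≫ K.d k = f := by
  obtain ⟨a, ha⟩ := K.exists_ker f hf
  obtain ⟨b, hb⟩ := K.exists_lift a
  exact ⟨b, by rw [d, reassoc_of% hb, ha]⟩

theorem exists_coker {Y : C} {k : ℕ} (f : K.Q k ⟶ Y) (hf : K.ι k ≫ f = 0) :
    ∃ g : K.X k ⟶ Y, K.π k ≫ g = f :=
  ⟨(K.exact k).exact.desc f hf, (K.exact k).exact.g_desc f hf⟩

/-- The graph of the transition homomorphism `t`: the class of `f` is related to the class
of any `f₁` that fits into a commutative diagram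
```
0 ⟶ K.X (p + 1) ⟶ K.Q p ⟶ K.X p ⟶ 0
         | f₁         | f₀      | f
0 ⟶ L.X (q + 1) ⟶ L.Q q ⟶ L.X q ⟶ 0
```
-/
def transGraph (p q : ℕ) :
    AddSubgroup (Stable (K.X p) (L.X q) × Stable (K.X (p + 1)) (L.X (q + 1))) where
  carrier := {x | ∃ (f : K.X p ⟶ L.X q) (f₀ : K.Q p ⟶ L.Q q) (f₁ : K.X (p + 1) ⟶ L.X (q + 1)),
    f₀ ≫ L.π q = K.π p ≫ f ∧ f₁ ≫ L.ι q = K.ι p ≫ f₀ ∧ x = (Stable.mk f, Stable.mk f₁)}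
  zero_mem' := ⟨0, 0, 0, by simp, by simp, rfl⟩
  add_mem' := by
    rintro _ _ ⟨f, f₀, f₁, h, h', rfl⟩ ⟨g, g₀, g₁, k, k', rfl⟩
    exact ⟨f + g, f₀ + g₀, f₁ + g₁, by simp [h, k], by simp [h', k'], rfl⟩
  neg_mem' := by
    rintro _ ⟨f, f₀, f₁, h, h', rfl⟩
    exact ⟨-f, -f₀, -f₁, by simp [h], by simp [h'], rfl⟩

theorem transGraph_total (p q : ℕ) (x : Stable (K.X p) (L.X q)) :
    ∃ y, (x, y) ∈ transGraph K L p q := by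
  obtain ⟨f, rfl⟩ := QuotientAddGroup.mk_surjective x
  obtain ⟨f₀, h₀⟩ := L.exists_lift (K.π p ≫ f)
  obtain ⟨f₁, h₁⟩ := L.exists_ker (K.ι p ≫ f₀) (by
    rw [Category.assoc, h₀, K.w_assoc, zero_comp])
  exact ⟨Stable.mk f₁, f, f₀, f₁, h₀, h₁, rfl⟩

theorem transGraph_single (p q : ℕ) (y : Stable (K.X (p + 1)) (L.X (q + 1)))
    (h : (0, y) ∈ transGraph K L p q) : y = 0 := by
  obtain ⟨f, f₀, f₁, h₀, h₁, h⟩ := h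
  obtain ⟨hf, rfl⟩ := Prod.mk.inj h
  obtain ⟨Q, _, a, b, rfl⟩ := Stable.mk_eq_zero.1 hf.symm
  obtain ⟨c, rfl⟩ := L.exists_lift b
  obtain ⟨e, he⟩ := L.exists_ker (f₀ - K.π p ≫ a ≫ c) (by simp [h₀])
  refine Stable.mk_eq_zero.2 ⟨K.Q p, inferInstance, K.ι p, e, ?_⟩
  rw [← cancel_mono (L.ι q), Category.assoc, he, h₁]
  simp [w_assoc]

/-- The transition homomorphism `t` from `[X p, X q]` to `[X (p + 1), X (q + 1)]`. -/
noncomputable def trans (p q : ℕ) :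
    Stable (K.X p) (L.X q) →+ Stable (K.X (p + 1)) (L.X (q + 1)) :=
  homOfGraph (transGraph K L p q) (transGraph_total K L p q) (transGraph_single K L p q)

variable {K L} in
theorem trans_mk {p q : ℕ} {f : K.X p ⟶ L.X q} (f₀ : K.Q p ⟶ L.Q q)
    {f₁ : K.X (p + 1) ⟶ L.X (q + 1)} (h₀ : f₀ ≫ L.π q = K.π p ≫ f)
    (h₁ : f₁ ≫ L.ι q = K.ι p ≫ f₀) :
    trans K L p q (Stable.mk f) = Stable.mk f₁ :=
  homOfGraph_eq ⟨f, f₀, f₁, h₀, h₁, rfl⟩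

end CutResolution

end Resolution

end

section

section Cut

variable {C : Type u} [Category.{v} C] [Abelian C] {M : C} (R : ProjectiveResolution M)

/-- A syzygy of a projective resolution with the epimorphism onto it. -/
structure Syzygy (k : ℕ) where
  X : C
  π : R.complex.X k ⟶ X
  w : R.complex.d (k + 1) k ≫ π = 0

/-- The syzygies: the `0`-th one is `M`, the `(k + 1)`-st one is the kernel of the
epimorphism from the `k`-th term of the resolution onto the `k`-th syzygy. -/
noncomputable def syzygy : ∀ k, Syzygy R k
  | 0 => ⟨M, R.π.f 0, R.complex_d_comp_π_f_zero⟩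
  | k + 1 =>
    { X := kernel (syzygy k).π
      π := kernel.lift (syzygy k).π (R.complex.d (k + 1) k) (syzygy k).w
      w := by rw [← cancel_mono (kernel.ι _)]; simp }

theorem syzygy_exact (k : ℕ) :
    (ShortComplex.mk _ _ (syzygy R k).w).Exact ∧ Epi (syzygy R k).π := by
  induction k with
  | zero => exact ⟨R.exact₀, inferInstanceAs (Epi (R.π.f 0))⟩
  | succ k ih =>
    obtain ⟨h, _⟩ := ih
    refine ⟨?_, h.epi_kernelLift⟩
    let φ : ShortComplex.mk _ _ (syzygy R (k + 1)).w ⟶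
        ShortComplex.mk _ _ (R.complex.d_comp_d (k + 2) (k + 1) k) :=
      { τ₁ := 𝟙 _, τ₂ := 𝟙 _, τ₃ := kernel.ι (syzygy R k).π
        comm₁₂ := by simp
        comm₂₃ := by simp [syzygy] }
    have : Epi φ.τ₁ := inferInstanceAs (Epi (𝟙 _))
    have : IsIso φ.τ₂ := inferInstanceAs (IsIso (𝟙 _))
    have : Mono φ.τ₃ := inferInstanceAs (Mono (kernel.ι _))
    exact (ShortComplex.exact_iff_of_epi_of_isIso_of_mono φ).2 (R.exact_succ k)

/-- A projective resolution of `M`, cut into short exact sequences. -/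
noncomputable def cut : CutResolution C where
  X k := (syzygy R k).X
  Q := R.complex.X
  ι k := kernel.ι (syzygy R k).π
  π k := (syzygy R k).π
  w _ := kernel.condition _
  exact k :=
    { exact := ShortComplex.exact_kernel _
      mono_f := inferInstanceAs (Mono (kernel.ι _))
      epi_g := (syzygy_exact R k).2 }
  proj := R.projective

theorem cut_X_zero : (cut R).X 0 = M := rfl

theorem cut_d (k : ℕ) : (cut R).d k = R.complex.d (k + 1) k :=
  kernel.lift_ι _ _ _

end Cut

/-- The pairs of natural numbers `(p, q)` with `p = q + n`. They are ordered in a sequence by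
`(p, q) ↦ (p + 1, q + 1)` and they index the direct systems with terms `[A_{n + k}, B_k]`,
where `k = q ≥ 0` and `n + k = p ≥ 0`. -/
@[ext]
structure Idx (n : ℤ) where
  p : ℕ
  q : ℕ
  h : (p : ℤ) = q + n

namespace Idx

/-- The next index. -/
abbrev succ {n : ℤ} (i : Idx n) : Idx n := ⟨i.p + 1, i.q + 1, by have := i.h; push_cast; omega⟩

/-- The index in degree `n + 1` with the same `q`. -/
abbrev up {n : ℤ} (i : Idx n) : Idx (n + 1) := ⟨i.p + 1, i.q, by have := i.h; push_cast; omega⟩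

end Idx

variable {C : Type u} [Category.{v} C] [Abelian C]

section Naive

/-- The terms of the naive construction for resolutions `K` of `A` and `L` of `B`. -/
abbrev BC (K L : CutResolution C) (n : ℤ) : Type v :=
  DirLim Idx.succ (fun i : Idx n => Stable (K.X i.p) (L.X i.q)) (fun i => K.trans L i.p i.q)

/-- The canonical homomorphism into the direct limit `BC K L n`. -/
noncomputable abbrev BC.of (K L : CutResolution C) {n : ℤ} (i : Idx n) :
    Stable (K.X i.p) (L.X i.q) →+ BC K L n :=
  DirLim.of (s := Idx.succ) (G := fun i : Idx n => Stable (K.X i.p) (L.X i.q))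
    (t := fun i => K.trans L i.p i.q) i

theorem BC.of_trans (K L : CutResolution C) {n : ℤ} (i : Idx n)
    (x : Stable (K.X i.p) (L.X i.q)) :
    BC.of K L i.succ (K.trans L i.p i.q x) = BC.of K L i x :=
  DirLim.of_trans (s := Idx.succ) (G := fun i : Idx n => Stable (K.X i.p) (L.X i.q))
    (t := fun i => K.trans L i.p i.q) i x

end Naive

section Ext

variable (K : CutResolution C)

/-- The kernel of `Hom(a_{p + 1}, B)`. -/
def cocycles (p : ℕ) (B : C) : AddSubgroup (K.Q p ⟶ B) where
  carrier := {f | K.d p ≫ f = 0}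
  zero_mem' := by simp
  add_mem' := by intro a b ha hb; simp_all
  neg_mem' := by intro a ha; simp_all

/-- The image of `Hom(a_p, B)`, where `a_0 = 0`. -/
def coboundaries (B : C) : ∀ p, AddSubgroup (K.Q p ⟶ B)
  | 0 => ⊥
  | p + 1 => (Preadditive.leftComp B (K.d p)).range

/-- The group `Ext^p(A, B)`, where `K` is a resolution of `A`. -/
abbrev ExtGrp (p : ℕ) (B : C) : Type v :=
  cocycles K p B ⧸ (coboundaries K B p).addSubgroupOf (cocycles K p B)

/-- The class of a cocycle in `Ext^p(A, B)`. -/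
abbrev ExtGrp.mk {K : CutResolution C} {p : ℕ} {B : C} (f : cocycles K p B) : ExtGrp K p B :=
  QuotientAddGroup.mk f

variable {K} in
theorem ExtGrp.mk_eq_zero {p : ℕ} {B : C} {f : cocycles K p B} :
    ExtGrp.mk f = 0 ↔ f.1 ∈ coboundaries K B p := by
  rw [QuotientAddGroup.eq_zero_iff]; rfl

/-- The homomorphism `Ext^p(A, g)`. -/
def ExtGrp.map (p : ℕ) {B B' : C} (g : B ⟶ B') : ExtGrp K p B →+ ExtGrp K p B' :=
  QuotientAddGroup.map _ _
    (((Preadditive.rightComp _ g).comp (cocycles K p B).subtype).codRestrict (cocycles K p B') (by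
      rintro ⟨f, hf⟩
      have hf : K.d p ≫ f = 0 := hf
      change K.d p ≫ f ≫ g = 0
      rw [reassoc_of% hf, zero_comp])) (by
    rintro ⟨f, hf⟩ h
    have h : f ∈ coboundaries K B p := h
    change f ≫ g ∈ coboundaries K B' p
    cases p with
    | zero =>
      obtain rfl : f = 0 := h
      exact zero_comp
    | succ p =>
      obtain ⟨u, rfl⟩ := h
      exact ⟨u ≫ g, by simp [Preadditive.leftComp]⟩)

variable (S : ShortComplex C)

/-- The graph of the connecting homomorphism `δ^p` of `Ext^•(A, -)`: a cocycle `f` with values in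
`S.X₃` is lifted to `S.X₂`; the differential of the lift has values in `S.X₁`. -/
def deltaGraph (p : ℕ) : AddSubgroup (ExtGrp K p S.X₃ × ExtGrp K (p + 1) S.X₁) where
  carrier := {x | ∃ (f : cocycles K p S.X₃) (e : K.Q p ⟶ S.X₂) (F : cocycles K (p + 1) S.X₁),
    e ≫ S.g = f.1 ∧ F.1 ≫ S.f = K.d p ≫ e ∧ x = (ExtGrp.mk f, ExtGrp.mk F)}
  zero_mem' := ⟨0, 0, 0, by simp, by simp, rfl⟩
  add_mem' := by
    rintro _ _ ⟨f, e, F, h, h', rfl⟩ ⟨f', e', F', k, k', rfl⟩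
    exact ⟨f + f', e + e', F + F', by simp [h, k], by simp [h', k'], rfl⟩
  neg_mem' := by
    rintro _ ⟨f, e, F, h, h', rfl⟩
    exact ⟨-f, -e, -F, by simp [h], by simp [h'], rfl⟩

variable {S}

theorem deltaGraph_total (hS : S.ShortExact) (p : ℕ) (x : ExtGrp K p S.X₃) : ∃ y, (x, y) ∈ deltaGraph K S p := by
  have := hS.mono_f
  have := hS.epi_g
  obtain ⟨f, rfl⟩ := QuotientAddGroup.mk_surjective x
  have hf : K.d p ≫ f.1 = 0 := f.2
  let e := Projective.factorThru f.1 S.g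
  have he : e ≫ S.g = f.1 := Projective.factorThru_comp _ _
  obtain ⟨F, hF⟩ := hS.exact.lift' (K.d p ≫ e) (by rw [Category.assoc, he, hf])
  refine ⟨ExtGrp.mk ⟨F, ?_⟩, f, e, ⟨F, _⟩, he, hF, rfl⟩
  change K.d (p + 1) ≫ F = 0
  rw [← cancel_mono S.f, Category.assoc, hF, K.d_d_assoc, zero_comp, zero_comp]

theorem deltaGraph_single (hS : S.ShortExact) (p : ℕ) (y : ExtGrp K (p + 1) S.X₁)
    (h : (0, y) ∈ deltaGraph K S p) : y = 0 := by
  have := hS.mono_f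
  have := hS.epi_g
  obtain ⟨f, e, F, he, hF, h⟩ := h
  obtain ⟨hf, rfl⟩ := Prod.mk.inj h
  have hf := ExtGrp.mk_eq_zero.1 hf.symm
  obtain ⟨e', he', hd⟩ : ∃ e' : K.Q p ⟶ S.X₂, e' ≫ S.g = f.1 ∧ K.d p ≫ e' = 0 := by
    cases p with
    | zero => exact ⟨0, by rw [show f.1 = 0 from hf, zero_comp], comp_zero⟩
    | succ p =>
      obtain ⟨u, hu⟩ := hf
      refine ⟨K.d p ≫ Projective.factorThru u S.g, ?_, by rw [K.d_d_assoc, zero_comp]⟩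
      rw [Category.assoc, Projective.factorThru_comp]
      exact hu
  obtain ⟨w, hw⟩ := hS.exact.lift' (e - e') (by simp [he, he'])
  refine ExtGrp.mk_eq_zero.2 ⟨w, ?_⟩
  change K.d p ≫ w = F.1
  rw [← cancel_mono S.f, hF, Category.assoc, hw, Preadditive.comp_sub, hd, sub_zero]

/-- The connecting homomorphism `δ^p` of `Ext^•(A, -)`. -/
noncomputable def delta (hS : S.ShortExact) (p : ℕ) : ExtGrp K p S.X₃ →+ ExtGrp K (p + 1) S.X₁ :=
  homOfGraph (deltaGraph K S p) (deltaGraph_total K hS p) (deltaGraph_single K hS p)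

variable {K} in
theorem delta_mk (hS : S.ShortExact) {p : ℕ} {f : cocycles K p S.X₃} (e : K.Q p ⟶ S.X₂)
    {F : cocycles K (p + 1) S.X₁} (he : e ≫ S.g = f.1) (hF : F.1 ≫ S.f = K.d p ≫ e) :
    delta K hS p (ExtGrp.mk f) = ExtGrp.mk F :=
  homOfGraph_eq ⟨f, e, F, he, hF, rfl⟩

end Ext

section Res

/-- The connecting homomorphism from `Ext^p(A, X q)` to `Ext^{p + 1}(A, X (q + 1))` of the short
exact sequence `0 ⟶ X (q + 1) ⟶ Q q ⟶ X q ⟶ 0`. -/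
noncomputable def deltaRes (K L : CutResolution C) (p q : ℕ) :
    ExtGrp K p (L.X q) →+ ExtGrp K (p + 1) (L.X (q + 1)) :=
  delta K (S := L.ses q) (L.exact q) p

theorem deltaRes_mk {K L : CutResolution C} {p q : ℕ} {f : cocycles K p (L.X q)}
    (e : K.Q p ⟶ L.Q q) {F : cocycles K (p + 1) (L.X (q + 1))} (he : e ≫ L.π q = f.1)
    (hF : F.1 ≫ L.ι q = K.d p ≫ e) : deltaRes K L p q (ExtGrp.mk f) = ExtGrp.mk F :=
  delta_mk (S := L.ses q) (L.exact q) e he hF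

/-- The terms of the resolution construction for `Ext^•(A, -)`, where `K` is a resolution of `A`
and `L` a resolution of `B`. Its direct system consists of the groups `Ext^{n + k}(A, X k)` with
`n + k ≥ 0`, the remaining ones being zero, and of the connecting homomorphisms. -/
abbrev ExtRes (K L : CutResolution C) (n : ℤ) : Type v :=
  DirLim Idx.succ (fun i : Idx n => ExtGrp K i.p (L.X i.q)) (fun i => deltaRes K L i.p i.q)

/-- The canonical homomorphism into the direct limit `ExtRes K L n`. -/
noncomputable abbrev ExtRes.of (K L : CutResolution C) {n : ℤ} (i : Idx n) :
    ExtGrp K i.p (L.X i.q) →+ ExtRes K L n :=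
  DirLim.of (s := Idx.succ) (G := fun i : Idx n => ExtGrp K i.p (L.X i.q))
    (t := fun i => deltaRes K L i.p i.q) i

theorem ExtRes.of_delta (K L : CutResolution C) {n : ℤ} (i : Idx n)
    (x : ExtGrp K i.p (L.X i.q)) :
    ExtRes.of K L i.succ (deltaRes K L i.p i.q x) = ExtRes.of K L i x :=
  DirLim.of_trans (s := Idx.succ) (G := fun i : Idx n => ExtGrp K i.p (L.X i.q))
    (t := fun i => deltaRes K L i.p i.q) i x

variable (K L : CutResolution C)

/-- The graph of `β_p` from `Ext^p(A, B)` to `[X p, B]`: the class of `f` is sent to the class of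
the morphism `f'` with `f = π_p ≫ f'`. -/
def betaGraph (p : ℕ) (B : C) : AddSubgroup (ExtGrp K p B × Stable (K.X p) B) where
  carrier := {x | ∃ (f : cocycles K p B) (f' : K.X p ⟶ B),
    K.π p ≫ f' = f.1 ∧ x = (ExtGrp.mk f, Stable.mk f')}
  zero_mem' := ⟨0, 0, by simp, rfl⟩
  add_mem' := by
    rintro _ _ ⟨f, f', h, rfl⟩ ⟨g, g', h', rfl⟩
    exact ⟨f + g, f' + g', by simp [h, h'], rfl⟩
  neg_mem' := by
    rintro _ ⟨f, f', h, rfl⟩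
    exact ⟨-f, -f', by simp [h], rfl⟩

theorem betaGraph_total (p : ℕ) (B : C) (x : ExtGrp K p B) : ∃ y, (x, y) ∈ betaGraph K p B := by
  obtain ⟨f, rfl⟩ := QuotientAddGroup.mk_surjective x
  have hf : K.d p ≫ f.1 = 0 := f.2
  obtain ⟨g, hg⟩ := K.exists_coker f.1 (by
    rw [← cancel_epi (K.π (p + 1)), comp_zero, ← Category.assoc]; exact hf)
  exact ⟨Stable.mk g, f, g, hg, rfl⟩

theorem betaGraph_single (p : ℕ) (B : C) (y : Stable (K.X p) B)
    (h : (0, y) ∈ betaGraph K p B) : y = 0 := by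
  obtain ⟨f, g, hg, h⟩ := h
  obtain ⟨hf, rfl⟩ := Prod.mk.inj h
  have hf := ExtGrp.mk_eq_zero.1 hf.symm
  rw [Stable.mk_eq_zero]
  cases p with
  | zero =>
    have : g = 0 := by rw [← cancel_epi (K.π 0), hg, comp_zero]; exact hf
    rw [this]; exact zero_mem _
  | succ p =>
    obtain ⟨u, hu⟩ := hf
    refine ⟨K.Q p, inferInstance, K.ι p, u, ?_⟩
    rw [← cancel_epi (K.π (p + 1)), hg, ← hu, ← Category.assoc]
    rfl

/-- The homomorphism `β_p` from `Ext^p(A, B)` to `[X p, B]`. -/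
noncomputable def betaLevel (p : ℕ) (B : C) : ExtGrp K p B →+ Stable (K.X p) B :=
  homOfGraph (betaGraph K p B) (betaGraph_total K p B) (betaGraph_single K p B)

variable {K} in
theorem betaLevel_mk {p : ℕ} {B : C} {f : cocycles K p B} {f' : K.X p ⟶ B}
    (h : K.π p ≫ f' = f.1) : betaLevel K p B (ExtGrp.mk f) = Stable.mk f' :=
  homOfGraph_eq ⟨f, f', h, rfl⟩

theorem betaLevel_delta (p q : ℕ) (x : ExtGrp K p (L.X q)) :
    betaLevel K (p + 1) (L.X (q + 1)) (deltaRes K L p q x) =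
      K.trans L p q (betaLevel K p (L.X q) x) := by
  obtain ⟨_, f, f', hf, h⟩ := betaGraph_total K p _ x
  obtain ⟨rfl, -⟩ := Prod.mk.inj h
  obtain ⟨f₀, h₀⟩ := L.exists_lift (K.π p ≫ f')
  obtain ⟨f₁, h₁⟩ := L.exists_ker (K.ι p ≫ f₀) (by
    rw [Category.assoc, h₀, K.w_assoc, zero_comp])
  rw [betaLevel_mk hf, CutResolution.trans_mk f₀ h₀ h₁,
    deltaRes_mk (F := ⟨K.π (p + 1) ≫ f₁, ?_⟩) f₀ (h₀.trans hf) ?_, betaLevel_mk rfl]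
  · change K.d (p + 1) ≫ K.π (p + 1) ≫ f₁ = 0
    rw [K.d_π_assoc, zero_comp]
  · simp [h₁, CutResolution.d]

/-- The homomorphism `β^n` from the resolution to the naive construction, the direct limit of the
homomorphisms `β_{n + k}`. -/
noncomputable def betaHom (n : ℤ) : ExtRes K L n →+ BC K L n :=
  DirLim.lift (fun i => (BC.of K L i).comp (betaLevel K i.p (L.X i.q))) (fun i x => by
    change BC.of K L i.succ (betaLevel K (i.p + 1) _ (deltaRes K L i.p i.q x)) =
      BC.of K L i (betaLevel K i.p _ x)
    rw [betaLevel_delta, BC.of_trans])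

end Res

end

section

namespace Idx

variable {n : ℤ}

theorem q_injective : Function.Injective (Idx.q : Idx n → ℕ) := by
  intro i j hij
  have := i.h
  have := j.h
  ext <;> omega

theorem finite_iff (s : Set (Idx n)) : s.Finite ↔ ∃ N, ∀ j ∈ s, j.q < N := by
  constructor
  · intro h
    obtain ⟨N, hN⟩ := (h.image Idx.q).bddAbove
    exact ⟨N + 1, fun j hj => Nat.lt_succ_of_le (hN ⟨j, hj, rfl⟩)⟩
  · rintro ⟨N, hN⟩
    refine Set.Finite.of_finite_image (f := Idx.q) ?_ q_injective.injOn
    exact (Set.finite_Iio N).subset (by rintro _ ⟨j, hj, rfl⟩; exact hN j hj)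

/-- The index `k` steps after `i`. -/
abbrev add (i : Idx n) (k : ℕ) : Idx n :=
  ⟨i.p + k, i.q + k, by have := i.h; push_cast; omega⟩

theorem exists_add {i j : Idx n} (h : i.q ≤ j.q) : ∃ k, j = i.add k := by
  obtain ⟨k, hk⟩ := Nat.exists_eq_add_of_le h
  exact ⟨k, q_injective hk⟩

theorem exists_extend {F : Idx n → Type*} [∀ j, Zero (F j)] {a : ℕ → Idx n}
    (ha : Function.Injective a) (x : ∀ k, F (a k)) :
    ∃ y : ∀ j, F j, (∀ k, y (a k) = x k) ∧ ∀ j, (∀ k, a k ≠ j) → y j = 0 := by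
  classical
  refine ⟨fun j => if h : ∃ k, a k = j then h.choose_spec ▸ x h.choose else 0, ?_, ?_⟩
  · intro k
    have h : ∃ l, a l = a k := ⟨k, rfl⟩
    have hl : h.choose = k := ha h.choose_spec
    beta_reduce
    rw [dif_pos h]
    generalize h.choose_spec = e
    revert e
    rw [hl]
    intro e
    rfl
  · intro j hj
    exact dif_neg (by rintro ⟨k, hk⟩; exact hj k hk)

theorem add_injective (i : Idx n) : Function.Injective i.add := by
  intro k l h
  simpa using congrArg Idx.q h

end Idx

variable {C : Type u} [Category.{v} C] [Abelian C] (K L : CutResolution C)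

/-- The `n`-cochains of the hypercohomology complex, that is, the elements of the product of the
groups `Hom(A_{k + n}, B_k)`. The factors with `k < 0` or `k + n < 0` are zero since the
resolutions are extended by zero to negative degrees. -/
abbrev Cochain (n : ℤ) : Type v := ∀ i : Idx n, K.Q i.p ⟶ L.Q i.q

variable {K L} in
/-- The composites of the components of a cochain with the differential of `A_•`, where
`A_{-1} = 0`. -/
def preD {n m : ℤ} (hm : n + 1 = m) (φ : Cochain K L n) : ∀ j : Idx m, K.Q j.p ⟶ L.Q j.q
  | ⟨0, _, _⟩ => 0
  | ⟨p + 1, q, h⟩ => K.d p ≫ φ ⟨p, q, by push_cast at h; omega⟩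

/-- The differential `d^n` of the hypercohomology complex,
`(d φ)_{n + 1 + k} = b_{k + 1} ∘ φ_{n + k + 1} - (-1)^n φ_{n + k} ∘ a_{n + k + 1}`. -/
def hypD {n m : ℤ} (hm : n + 1 = m) : Cochain K L n →+ Cochain K L m :=
  AddMonoidHom.mk' (fun φ j => φ ⟨j.p, j.q + 1, by have := j.h; push_cast; omega⟩ ≫ L.d j.q -
      n.negOnePow • preD hm φ j) (by
    intro φ ψ
    funext ⟨p, q, h⟩
    cases p <;> simp [preD] <;> abel)

variable {K L} in
theorem hypD_zero {n m : ℤ} (hm : n + 1 = m) (φ : Cochain K L n) (q : ℕ)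
    (h : ((0 : ℕ) : ℤ) = q + m) :
    hypD K L hm φ ⟨0, q, h⟩ = φ ⟨0, q + 1, by push_cast at *; omega⟩ ≫ L.d q := by
  simp [hypD, preD]

variable {K L} in
theorem hypD_succ {n m : ℤ} (hm : n + 1 = m) (φ : Cochain K L n) (p q : ℕ)
    (h : ((p + 1 : ℕ) : ℤ) = q + m) :
    hypD K L hm φ ⟨p + 1, q, h⟩ = φ ⟨p + 1, q + 1, by push_cast at *; omega⟩ ≫ L.d q -
      n.negOnePow • K.d p ≫ φ ⟨p, q, by push_cast at *; omega⟩ := by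
  simp [hypD, preD]

/-- The almost chain maps `A[n]_• ⟶ B_•`: all but finitely many squares commute. -/
def almostHom (n : ℤ) : AddSubgroup (Cochain K L n) where
  carrier := {φ | {j | hypD K L rfl φ j ≠ 0}.Finite}
  zero_mem' := by simp
  add_mem' := by
    intro φ ψ hφ hψ
    refine (Set.Finite.union hφ hψ).subset fun j hj => ?_
    by_contra h
    simp only [Set.mem_union, Set.mem_ofPred_eq, not_or, not_not] at h
    exact hj (by rw [map_add, Pi.add_apply, h.1, h.2, add_zero])
  neg_mem' := by
    intro φ hφ
    refine Set.Finite.subset hφ fun j hj h => hj ?_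
    rw [map_neg, Pi.neg_apply, h, neg_zero]

/-- The nullhomotopic almost chain maps `A[n]_• ⟶ B_•`: a homotopy exists for all but finitely
many components. -/
def almostNull (n : ℤ) : AddSubgroup (Cochain K L n) where
  carrier := {φ | ∃ e : Cochain K L (n - 1), {j | φ j ≠ hypD K L (by ring) e j}.Finite}
  zero_mem' := ⟨0, by simp⟩
  add_mem' := by
    rintro φ ψ ⟨e, he⟩ ⟨f, hf⟩
    refine ⟨e + f, (Set.Finite.union he hf).subset fun j hj => ?_⟩
    by_contra h
    simp only [Set.mem_union, Set.mem_ofPred_eq, not_or, not_not] at h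
    exact hj (by rw [map_add, Pi.add_apply, Pi.add_apply, h.1, h.2])
  neg_mem' := by
    rintro φ ⟨e, he⟩
    refine ⟨-e, he.subset fun j hj h => hj ?_⟩
    rw [map_neg, Pi.neg_apply, Pi.neg_apply, h]

/-- The terms of the hypercohomology construction: almost chain maps `A[n]_• ⟶ B_•` modulo the
nullhomotopic ones. These are the cohomology groups of the Vogel complex. -/
abbrev VExt (n : ℤ) : Type v :=
  almostHom K L n ⧸ (almostNull K L n).addSubgroupOf (almostHom K L n)

variable {K L}

/-- The class of an almost chain map. -/
abbrev VExt.mk {n : ℤ} (φ : almostHom K L n) : VExt K L n := QuotientAddGroup.mk φ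

theorem VExt.mk_eq_zero {n : ℤ} {φ : almostHom K L n} :
    VExt.mk φ = 0 ↔ φ.1 ∈ almostNull K L n := by
  rw [QuotientAddGroup.eq_zero_iff]; rfl

/-- The squares of `φ` commute in all degrees from the one given by `i` on, that is, the components
of `φ` from `i` on form a chain map. -/
def IsChainFrom {n : ℤ} (i : Idx n) (φ : Cochain K L n) : Prop :=
  ∀ j : Idx (n + 1), i.q ≤ j.q → hypD K L rfl φ j = 0

theorem isChainFrom_iff {n : ℤ} {i : Idx n} {φ : Cochain K L n} :
    IsChainFrom i φ ↔ ∀ k, φ (i.add (k + 1)) ≫ L.d (i.q + k) =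
      n.negOnePow • K.d (i.p + k) ≫ φ (i.add k) := by
  constructor
  · intro h k
    have := h (i.add k).up (by simp)
    exact sub_eq_zero.1 ((hypD_succ rfl φ _ _ _).symm.trans this)
  · rintro h j hj
    obtain ⟨k, rfl⟩ := Idx.exists_add (i := i.up) hj
    have := hypD_succ rfl φ (i.p + k) (i.q + k) (by have := i.h; push_cast; omega)
    have h2 : i.up.add k = ⟨i.p + k + 1, i.q + k, by have := i.h; push_cast; omega⟩ := by
      ext <;> simp; omega
    rw [h2, this]
    exact sub_eq_zero.2 (h k)

theorem IsChainFrom.mono {n : ℤ} {i j : Idx n} {φ : Cochain K L n} (h : IsChainFrom i φ)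
    (hij : i.q ≤ j.q) : IsChainFrom j φ := fun l hl => h l (hij.trans hl)

theorem IsChainFrom.mem {n : ℤ} {i : Idx n} {φ : Cochain K L n} (h : IsChainFrom i φ) :
    φ ∈ almostHom K L n :=
  (Idx.finite_iff _).2 ⟨i.q, fun j hj => not_le.1 fun hij => hj (h j hij)⟩

theorem exists_isChainFrom {n : ℤ} {φ : Cochain K L n} (h : φ ∈ almostHom K L n) :
    ∃ N, ∀ i : Idx n, N ≤ i.q → IsChainFrom i φ := by
  obtain ⟨N, hN⟩ := (Idx.finite_iff _).1 h
  refine ⟨N, fun i hi j hj => ?_⟩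
  by_contra hne
  exact absurd (hN j hne) (by omega)

/-- A morphism into a syzygy lifts to a chain map. -/
theorem exists_chainMap {n : ℤ} (i : Idx n) (f : K.Q i.p ⟶ L.X i.q) (hf : K.d i.p ≫ f = 0) :
    ∃ φ : Cochain K L n, φ i ≫ L.π i.q = f ∧ IsChainFrom i φ ∧ ∀ j : Idx n, j.q < i.q → φ j = 0 := by
  let T : ℕ → Type v := fun k =>
    {x : K.Q (i.p + k) ⟶ L.Q (i.q + k) // (K.d (i.p + k) ≫ x) ≫ L.π (i.q + k) = 0}
  have step : ∀ k (x : T k), ∃ y : T (k + 1), y.1 ≫ L.d (i.q + k) =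
      n.negOnePow • K.d (i.p + k) ≫ x.1 := by
    intro k ⟨x, hx⟩
    obtain ⟨y, hy⟩ := L.exists_d (n.negOnePow • K.d (i.p + k) ≫ x) (by
      rw [Linear.units_smul_comp, hx, smul_zero])
    refine ⟨⟨y, ?_⟩, hy⟩
    rw [← cancel_mono (L.ι (i.q + k)), zero_comp, Category.assoc]
    change (K.d (i.p + k + 1) ≫ y) ≫ L.d (i.q + k) = 0
    rw [Category.assoc, hy, Linear.comp_units_smul, K.d_d_assoc, zero_comp, smul_zero]
  choose next hnext using step
  obtain ⟨x₀, hx₀⟩ := L.exists_lift f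
  let x : ∀ k, T k := fun k => Nat.rec ⟨x₀, by rw [Category.assoc]; exact (congrArg _ hx₀).trans hf⟩
    next k
  obtain ⟨φ, h, h'⟩ := Idx.exists_extend (F := fun j => (K.Q j.p ⟶ L.Q j.q))
    i.add_injective (fun k => (x k).1)
  refine ⟨φ, ?_, ?_, fun j hj => h' j ?_⟩
  · exact (congrArg (· ≫ L.π i.q) (h 0)).trans hx₀
  · rw [isChainFrom_iff]
    intro k
    rw [h, h]
    exact hnext k (x k)
  · rintro k rfl
    simp at hj

/-- A chain map is nullhomotopic in high degrees if it lifts a coboundary. -/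
theorem mem_almostNull {n : ℤ} (i : Idx n) {φ : Cochain K L n} (h : IsChainFrom i φ)
    (hf : φ i ≫ L.π i.q ∈ coboundaries K (L.X i.q) i.p) : φ ∈ almostNull K L n := by
  rw [isChainFrom_iff] at h
  let T : ℕ → Type v := fun k =>
    {x : K.Q (i.p + k) ⟶ L.Q (i.q + k + 1) //
      K.d (i.p + k) ≫ (φ (i.add k) - x ≫ L.d (i.q + k)) = 0}
  have step : ∀ k (x : T k), ∃ y : T (k + 1), φ (i.add (k + 1)) =
      y.1 ≫ L.d (i.q + k + 1) + n.negOnePow • K.d (i.p + k) ≫ x.1 := by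
    intro k ⟨x, hx⟩
    have h₁ : (φ (i.add (k + 1)) - n.negOnePow • K.d (i.p + k) ≫ x) ≫ L.π (i.q + k + 1) = 0 := by
      rw [← cancel_mono (L.ι (i.q + k)), zero_comp, Category.assoc]
      change _ ≫ L.d (i.q + k) = 0
      rw [Preadditive.sub_comp, h, Linear.units_smul_comp, ← smul_sub, Category.assoc,
        ← Preadditive.comp_sub, hx, smul_zero]
    obtain ⟨y, hy⟩ : ∃ y : K.Q (i.p + k + 1) ⟶ L.Q (i.q + k + 1 + 1), y ≫ L.d (i.q + k + 1) =
      φ (i.add (k + 1)) - n.negOnePow • K.d (i.p + k) ≫ x := L.exists_d _ h₁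
    refine ⟨⟨y, ?_⟩, ?_⟩
    · change K.d (i.p + k + 1) ≫ (φ (i.add (k + 1)) - y ≫ L.d (i.q + k + 1)) = 0
      rw [hy, sub_sub_cancel, Linear.comp_units_smul, K.d_d_assoc, zero_comp, smul_zero]
    · rw [hy, sub_add_cancel]
  have start : Nonempty (T 0) := by
    obtain ⟨r, hr, hr'⟩ : ∃ r : K.Q i.p ⟶ L.Q i.q, r ≫ L.π i.q = φ i ≫ L.π i.q ∧
        K.d i.p ≫ r = 0 := by
      obtain ⟨p, q, hi⟩ := i
      cases p with
      | zero => exact ⟨0, by rw [zero_comp]; exact hf.symm, comp_zero⟩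
      | succ p =>
        obtain ⟨u, hu⟩ := hf
        obtain ⟨v, hv⟩ := L.exists_lift u
        refine ⟨K.d p ≫ v, ?_, by rw [K.d_d_assoc, zero_comp]⟩
        rw [Category.assoc, hv]
        exact hu
    obtain ⟨x, hx⟩ := L.exists_d (φ i - r) (by rw [Preadditive.sub_comp, hr, sub_self])
    refine ⟨⟨x, ?_⟩⟩
    change K.d i.p ≫ (φ i - x ≫ L.d i.q) = 0
    rw [hx, sub_sub_cancel, hr']
  choose next hnext using step
  let x : ∀ k, T k := fun k => Nat.rec start.some next k
  let a : ℕ → Idx (n - 1) := fun k =>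
    ⟨i.p + k, i.q + k + 1, by have := i.h; push_cast; omega⟩
  obtain ⟨e, he, -⟩ := Idx.exists_extend (F := fun j => (K.Q j.p ⟶ L.Q j.q)) (a := a)
    (fun k l hkl => by simpa [a] using congrArg Idx.q hkl) (fun k => (x k).1)
  refine ⟨e, (Idx.finite_iff _).2 ⟨i.q + 1, fun j hj => ?_⟩⟩
  by_contra hlt
  refine hj ?_
  obtain ⟨k, rfl⟩ := Idx.exists_add (i := i.succ) (not_lt.1 hlt)
  have h2 : i.succ.add k = ⟨i.p + k + 1, i.q + k + 1, by have := i.h; push_cast; omega⟩ := by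
    ext <;> simp <;> omega
  rw [h2, hypD_succ]
  rw [Int.negOnePow_sub, Int.negOnePow_one, mul_neg, mul_one, Units.neg_smul, sub_neg_eq_add]
  refine (hnext k (x k)).trans ?_
  congr 1
  · exact congrArg (· ≫ L.d (i.q + k + 1)) (he (k + 1)).symm
  · exact congrArg (fun z => n.negOnePow • K.d (i.p + k) ≫ z) (he k).symm

end

section

variable {C : Type u} [Category.{v} C] [Abelian C] {K L : CutResolution C}

theorem isChainFrom_zero {n : ℤ} (i : Idx n) : IsChainFrom i (0 : Cochain K L n) :=
  fun j _ => by rw [map_zero, Pi.zero_apply]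

theorem IsChainFrom.add {n : ℤ} {i : Idx n} {φ ψ : Cochain K L n} (hφ : IsChainFrom i φ)
    (hψ : IsChainFrom i ψ) : IsChainFrom i (φ + ψ) :=
  fun j hj => by rw [map_add, Pi.add_apply, hφ j hj, hψ j hj, add_zero]

theorem IsChainFrom.neg {n : ℤ} {i : Idx n} {φ : Cochain K L n} (hφ : IsChainFrom i φ) :
    IsChainFrom i (-φ) :=
  fun j hj => by rw [map_neg, Pi.neg_apply, hφ j hj, neg_zero]

section Sigma

/-- The graph of the homomorphism `ϑ ∘ ζ` from `Ext^p(A, X q)` to the `n`-th term of the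
hypercohomology construction, where `i = (p, q)`, `p = q + n` and `q` is even: the class of `f` is
sent by `ζ` to the class of a chain map `A[n + q]_• ⟶ B_{• + q}` lifting `f`, which `ϑ` extends by
zero to an almost chain map `A[n]_• ⟶ B_•`. -/
def sigmaGraph (K L : CutResolution C) {n : ℤ} (i : Idx n) :
    AddSubgroup (ExtGrp K i.p (L.X i.q) × VExt K L n) where
  carrier := {x | ∃ (f : cocycles K i.p (L.X i.q)) (φ : almostHom K L n),
    φ.1 i ≫ L.π i.q = f.1 ∧ IsChainFrom i φ.1 ∧ (∀ j : Idx n, j.q < i.q → φ.1 j = 0) ∧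
      x = (ExtGrp.mk f, VExt.mk φ)}
  zero_mem' := ⟨0, 0, by simp, isChainFrom_zero i, by simp, rfl⟩
  add_mem' := by
    rintro _ _ ⟨f, φ, h, h', h'', rfl⟩ ⟨g, ψ, k, k', k'', rfl⟩
    exact ⟨f + g, φ + ψ, by simp [← h, ← k], h'.add k', fun j hj => by simp [h'' j hj, k'' j hj],
      rfl⟩
  neg_mem' := by
    rintro _ ⟨f, φ, h, h', h'', rfl⟩
    exact ⟨-f, -φ, by simp [← h], h'.neg, fun j hj => by simp [h'' j hj], rfl⟩

theorem sigmaGraph_total {n : ℤ} (i : Idx n) (x : ExtGrp K i.p (L.X i.q)) :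
    ∃ y, (x, y) ∈ sigmaGraph K L i := by
  obtain ⟨f, rfl⟩ := QuotientAddGroup.mk_surjective x
  obtain ⟨φ, h, h', h''⟩ := exists_chainMap i f.1 f.2
  exact ⟨VExt.mk ⟨φ, h'.mem⟩, f, ⟨φ, h'.mem⟩, h, h', h'', rfl⟩

theorem sigmaGraph_single {n : ℤ} (i : Idx n) (y : VExt K L n)
    (h : (0, y) ∈ sigmaGraph K L i) : y = 0 := by
  obtain ⟨f, φ, h, h', -, h''⟩ := h
  obtain ⟨hf, rfl⟩ := Prod.mk.inj h''
  exact VExt.mk_eq_zero.2 (mem_almostNull i h' (h ▸ ExtGrp.mk_eq_zero.1 hf.symm))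

/-- The homomorphism `ϑ ∘ ζ` on `Ext^p(A, X q)`, where `i = (p, q)`. -/
noncomputable def sigmaLevel (K L : CutResolution C) {n : ℤ} (i : Idx n) :
    ExtGrp K i.p (L.X i.q) →+ VExt K L n :=
  homOfGraph (sigmaGraph K L i) (sigmaGraph_total i) (sigmaGraph_single i)

theorem sigmaLevel_mk {n : ℤ} {i : Idx n} {f : cocycles K i.p (L.X i.q)} {φ : almostHom K L n}
    (h : φ.1 i ≫ L.π i.q = f.1) (h' : IsChainFrom i φ.1)
    (h'' : ∀ j : Idx n, j.q < i.q → φ.1 j = 0) :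
    sigmaLevel K L i (ExtGrp.mk f) = VExt.mk φ :=
  homOfGraph_eq ⟨f, φ, h, h', h'', rfl⟩

theorem cocycle_comp {p : ℕ} {B : C} (f : K.X p ⟶ B) : K.π p ≫ f ∈ cocycles K p B := by
  change K.d p ≫ K.π p ≫ f = 0
  rw [K.d_π_assoc, zero_comp]

theorem exists_cocycle {p : ℕ} {B : C} (f : cocycles K p B) : ∃ g : K.X p ⟶ B, K.π p ≫ g = f.1 := by
  have hf : K.d p ≫ f.1 = 0 := f.2
  exact K.exists_coker f.1 (by
    rw [← cancel_epi (K.π (p + 1)), comp_zero, ← Category.assoc]; exact hf)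

/-- The morphism between the syzygies that is induced by a chain map. -/
theorem IsChainFrom.exists_syzygy {n : ℤ} {i : Idx n} {φ : Cochain K L n} (h : IsChainFrom i φ) :
    ∃ g : K.X i.p ⟶ L.X i.q, K.π i.p ≫ g = φ i ≫ L.π i.q := by
  refine K.exists_coker _ ?_
  rw [← cancel_epi (K.π (i.p + 1)), comp_zero, ← Category.assoc]
  change K.d i.p ≫ φ i ≫ L.π i.q = 0
  have := isChainFrom_iff.1 h 0
  rw [← Category.assoc, ← smul_eq_zero_iff_eq n.negOnePow, ← Linear.units_smul_comp]
  refine (congrArg (· ≫ L.π i.q) this.symm).trans ?_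
  simp [CutResolution.d_π]

theorem deltaRes_chain {n : ℤ} {i : Idx n} {φ : Cochain K L n} (h : IsChainFrom i φ)
    {f : cocycles K i.p (L.X i.q)} {F : cocycles K (i.p + 1) (L.X (i.q + 1))}
    (hf : φ i ≫ L.π i.q = f.1) (hF : φ i.succ ≫ L.π (i.q + 1) = F.1) :
    deltaRes K L i.p i.q (ExtGrp.mk f) = n.negOnePow • ExtGrp.mk F := by
  have h0 : φ i.succ ≫ L.d i.q = n.negOnePow • K.d i.p ≫ φ i := isChainFrom_iff.1 h 0
  have : n.negOnePow • ExtGrp.mk F = ExtGrp.mk (n.negOnePow • F) := rfl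
  rw [this]
  refine deltaRes_mk (φ i) hf ?_
  change (n.negOnePow • F.1) ≫ _ = _
  rw [← hF, Linear.units_smul_comp, Category.assoc]
  change n.negOnePow • φ i.succ ≫ L.d i.q = _
  rw [h0, smul_smul, Int.units_mul_self, one_smul]

theorem sigmaLevel_deltaRes {n : ℤ} (i : Idx n) (x : ExtGrp K i.p (L.X i.q)) :
    sigmaLevel K L i.succ.succ (deltaRes K L i.succ.p i.succ.q (deltaRes K L i.p i.q x)) =
      sigmaLevel K L i x := by
  obtain ⟨_, f, φ, hf, hφ, h0, h⟩ := sigmaGraph_total i x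
  obtain ⟨rfl, -⟩ := Prod.mk.inj h
  have h₁ : IsChainFrom i.succ φ.1 := hφ.mono (by simp)
  have h₂ : IsChainFrom i.succ.succ φ.1 := h₁.mono (by simp)
  obtain ⟨g₁, hg₁⟩ := h₁.exists_syzygy
  obtain ⟨g₂, hg₂⟩ := h₂.exists_syzygy
  rw [sigmaLevel_mk hf hφ h0,
    deltaRes_chain hφ hf (F := ⟨_, cocycle_comp g₁⟩) hg₁.symm, map_zsmul_unit,
    deltaRes_chain h₁ hg₁.symm (F := ⟨_, cocycle_comp g₂⟩) hg₂.symm, smul_smul,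
    Int.units_mul_self, one_smul]
  obtain ⟨ψ, hψ, hψ', hψ''⟩ : ∃ ψ : Cochain K L n, (∀ j : Idx n, i.q + 2 ≤ j.q → ψ j = φ.1 j) ∧
      IsChainFrom i.succ.succ ψ ∧ ∀ j : Idx n, j.q < i.q + 2 → ψ j = 0 := by
    classical
    refine ⟨fun j => if i.q + 2 ≤ j.q then φ.1 j else 0, fun j hj => if_pos hj, ?_,
      fun j hj => if_neg (by omega)⟩
    rw [isChainFrom_iff] at h₂ ⊢
    intro k
    rw [if_pos (by simp), if_pos (by simp)]
    exact h₂ k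
  rw [sigmaLevel_mk (φ := ⟨ψ, hψ'.mem⟩) (by
      change ψ i.succ.succ ≫ _ = _
      rw [hψ _ (by simp)]
      exact hg₂.symm) hψ' hψ'', ← sub_eq_zero]
  refine (VExt.mk_eq_zero (φ := ⟨ψ, hψ'.mem⟩ - φ)).2 ⟨0, (Idx.finite_iff _).2 ⟨i.q + 2, ?_⟩⟩
  intro j hj
  by_contra hlt
  exact hj (by simp [hψ j (not_lt.1 hlt)])

open Classical in
/-- The homomorphism `σ^n = ϑ^n ∘ ζ^n` from the resolution to the hypercohomology construction. It
is the direct limit over the cofinal system of the terms `Ext^p(A, X q)` with `q` even. -/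
noncomputable def sigmaHom (K L : CutResolution C) (n : ℤ) : ExtRes K L n →+ VExt K L n :=
  DirLim.lift (s := Idx.succ) (G := fun i : Idx n => ExtGrp K i.p (L.X i.q))
    (t := fun i => deltaRes K L i.p i.q)
    (fun i => if Even i.q then sigmaLevel K L i
      else (sigmaLevel K L i.succ).comp (deltaRes K L i.p i.q)) (fun i x => by
    by_cases h : Even i.q
    · have h' : ¬ Even i.succ.q := by simpa [Nat.even_add_one] using h
      rw [if_pos h, if_neg h']
      exact sigmaLevel_deltaRes i x
    · have h' : Even i.succ.q := by simpa [Nat.even_add_one] using h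
      rw [if_neg h, if_pos h']
      rfl)

end Sigma

section Rho

/-- The relation between an almost chain map `φ` and the element of the naive construction that is
represented by the morphism between the syzygies induced by `φ` at the index `i`. -/
def SyzygyRel {n : ℤ} (φ : Cochain K L n) (i : Idx n) (y : BC K L n) : Prop :=
  IsChainFrom i φ ∧ ∃ g : K.X i.p ⟶ L.X i.q, K.π i.p ≫ g = φ i ≫ L.π i.q ∧
    y = BC.of K L i (Stable.mk g)

theorem SyzygyRel.exists {n : ℤ} {φ : Cochain K L n} {i : Idx n} (h : IsChainFrom i φ) :
    ∃ y, SyzygyRel φ i y := by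
  obtain ⟨g, hg⟩ := h.exists_syzygy
  exact ⟨_, h, g, hg, rfl⟩

theorem SyzygyRel.unique {n : ℤ} {φ : Cochain K L n} {i : Idx n} {y z : BC K L n}
    (hy : SyzygyRel φ i y) (hz : SyzygyRel φ i z) : y = z := by
  obtain ⟨-, g, hg, rfl⟩ := hy
  obtain ⟨-, h, hh, rfl⟩ := hz
  obtain rfl : g = h := by rw [← cancel_epi (K.π i.p), hg, hh]
  rfl

theorem SyzygyRel.succ {n : ℤ} {φ : Cochain K L n} {i : Idx n} {y : BC K L n}
    (hy : SyzygyRel φ i y) : SyzygyRel φ i.succ (n.negOnePow • y) := by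
  obtain ⟨h, g, hg, rfl⟩ := hy
  have h₁ : IsChainFrom i.succ φ := h.mono (by simp)
  obtain ⟨g₁, hg₁⟩ := h₁.exists_syzygy
  refine ⟨h₁, g₁, hg₁, ?_⟩
  have h0 : φ i.succ ≫ L.d i.q = n.negOnePow • K.d i.p ≫ φ i := isChainFrom_iff.1 h 0
  have : K.trans L i.p i.q (Stable.mk g) = n.negOnePow • Stable.mk g₁ := by
    refine CutResolution.trans_mk (φ i) hg.symm (f₁ := n.negOnePow • g₁) ?_
    rw [← cancel_epi (K.π (i.p + 1)), Linear.units_smul_comp, Linear.comp_units_smul,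
      ← Category.assoc, hg₁, ← Category.assoc]
    change n.negOnePow • (φ i.succ ≫ L.π (i.q + 1)) ≫ L.ι i.q = K.d i.p ≫ φ i
    rw [Category.assoc]
    change n.negOnePow • φ i.succ ≫ L.d i.q = _
    rw [h0, smul_smul, Int.units_mul_self, one_smul]
  rw [← BC.of_trans, this, map_zsmul_unit, smul_smul, Int.units_mul_self, one_smul]

theorem SyzygyRel.even {n : ℤ} {φ : Cochain K L n} {i j : Idx n} {y : BC K L n}
    (hy : SyzygyRel φ i y) (hi : Even i.q) (hj : Even j.q) (hij : i.q ≤ j.q) :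
    SyzygyRel φ j y := by
  obtain ⟨k, rfl⟩ := Idx.exists_add hij
  obtain ⟨l, rfl⟩ : Even k := by
    simpa [Nat.even_add, hi] using hj
  clear hij hj
  induction l with
  | zero => exact hy
  | succ l ih =>
    have := ih.succ.succ
    rw [smul_smul, Int.units_mul_self, one_smul] at this
    convert this using 1
    ext <;> simp <;> omega

theorem SyzygyRel.zero {n : ℤ} (i : Idx n) : SyzygyRel (0 : Cochain K L n) i 0 :=
  ⟨isChainFrom_zero i, 0, by simp, (map_zero (BC.of K L i)).symm⟩

theorem SyzygyRel.add {n : ℤ} {φ ψ : Cochain K L n} {i : Idx n} {y z : BC K L n}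
    (hy : SyzygyRel φ i y) (hz : SyzygyRel ψ i z) : SyzygyRel (φ + ψ) i (y + z) := by
  obtain ⟨h, g, hg, rfl⟩ := hy
  obtain ⟨k, g', hg', rfl⟩ := hz
  exact ⟨h.add k, g + g', by simp [hg, hg'], (map_add (BC.of K L i) _ _).symm⟩

theorem SyzygyRel.neg {n : ℤ} {φ : Cochain K L n} {i : Idx n} {y : BC K L n}
    (hy : SyzygyRel φ i y) : SyzygyRel (-φ) i (-y) := by
  obtain ⟨h, g, hg, rfl⟩ := hy
  exact ⟨h.neg, -g, by simp [hg], (map_neg (BC.of K L i) _).symm⟩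

theorem Idx.exists_even (n : ℤ) (N : ℕ) : ∃ i : Idx n, Even i.q ∧ N ≤ i.q ∧ N < i.p := by
  obtain ⟨m, hm⟩ : ∃ m : ℕ, -n ≤ m := ⟨n.natAbs, by omega⟩
  have := Int.toNat_of_nonneg (a := 2 * (N + 1 + m) + n) (by omega)
  refine ⟨⟨(2 * (N + 1 + m) + n).toNat, 2 * (N + 1 + m), ?_⟩, even_two_mul _, ?_, ?_⟩
  · push_cast; omega
  · dsimp only; omega
  · dsimp only; omega

/-- If a nullhomotopic almost chain map induces a morphism between syzygies in high degree, this
morphism factors through a projective object. -/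
theorem SyzygyRel.eq_zero {n : ℤ} {φ : Cochain K L n} {e : Cochain K L (n - 1)} {N : ℕ}
    (he : ∀ j : Idx n, N ≤ j.q → φ j = hypD K L (by ring) e j) {i : Idx n} (hi : N ≤ i.q)
    (hi' : 0 < i.p) {y : BC K L n} (hy : SyzygyRel φ i y) : y = 0 := by
  obtain ⟨-, g, hg, rfl⟩ := hy
  obtain ⟨p, q, h⟩ := i
  obtain ⟨p, rfl⟩ := Nat.exists_eq_succ_of_ne_zero hi'.ne'
  have h1 := he _ hi
  rw [hypD_succ] at h1
  change K.π (p + 1) ≫ g = _ ≫ L.π q at hg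
  suffices Stable.mk g = 0 by rw [this, map_zero]
  refine Stable.mk_eq_zero.2 ⟨K.Q p, inferInstance, K.ι p,
    -((n - 1).negOnePow • e ⟨p, q, by push_cast at h; omega⟩ ≫ L.π q), ?_⟩
  rw [← cancel_epi (K.π (p + 1)), hg, h1]
  simp [CutResolution.w, CutResolution.d]

/-- The graph of `ρ^n`: if the almost chain map `φ` is a chain map from the index `i = (p, q)` on,
where `q` is even, then the class of `φ` is sent to the element represented by the morphism
`X p ⟶ X q` between the syzygies that is induced by `φ`. -/
def rhoGraph (K L : CutResolution C) (n : ℤ) : AddSubgroup (VExt K L n × BC K L n) where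
  carrier := {x | ∃ (φ : almostHom K L n) (i : Idx n), Even i.q ∧ ∃ y, SyzygyRel φ.1 i y ∧
    x = (VExt.mk φ, y)}
  zero_mem' := by
    obtain ⟨i, hi, -⟩ := Idx.exists_even n 0
    exact ⟨0, i, hi, 0, SyzygyRel.zero i, rfl⟩
  add_mem' := by
    rintro _ _ ⟨φ, i, hi, y, h, rfl⟩ ⟨ψ, j, hj, z, k, rfl⟩
    rcases le_total i.q j.q with hij | hij
    · exact ⟨φ + ψ, j, hj, y + z, (h.even hi hj hij).add k, rfl⟩
    · exact ⟨φ + ψ, i, hi, y + z, h.add (k.even hj hi hij), rfl⟩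
  neg_mem' := by
    rintro _ ⟨φ, i, hi, y, h, rfl⟩
    exact ⟨-φ, i, hi, -y, h.neg, rfl⟩

theorem rhoGraph_total (n : ℤ) (x : VExt K L n) : ∃ y, (x, y) ∈ rhoGraph K L n := by
  obtain ⟨φ, rfl⟩ := QuotientAddGroup.mk_surjective x
  obtain ⟨N, hN⟩ := exists_isChainFrom φ.2
  obtain ⟨i, hi, hi', -⟩ := Idx.exists_even n N
  obtain ⟨y, hy⟩ := SyzygyRel.exists (hN i hi')
  exact ⟨y, φ, i, hi, y, hy, rfl⟩

theorem rhoGraph_single (n : ℤ) (y : BC K L n) (h : (0, y) ∈ rhoGraph K L n) : y = 0 := by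
  obtain ⟨φ, i, hi, _, hy, h⟩ := h
  obtain ⟨hφ, rfl⟩ := Prod.mk.inj h
  obtain ⟨e, he⟩ := VExt.mk_eq_zero.1 hφ.symm
  obtain ⟨N, hN⟩ := (Idx.finite_iff _).1 he
  obtain ⟨j, hj, hj', hj''⟩ := Idx.exists_even n (max N i.q)
  have hj1 : N ≤ j.q := (le_max_left _ _).trans hj'
  refine SyzygyRel.eq_zero (N := N) (e := e) (fun l hl => ?_) hj1 (by omega)
    (hy.even hi hj ((le_max_right _ _).trans hj'))
  by_contra hne
  exact absurd (hN l hne) (by omega)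

/-- The homomorphism `ρ^n` from the hypercohomology to the naive construction. -/
noncomputable def rhoHom (K L : CutResolution C) (n : ℤ) : VExt K L n →+ BC K L n :=
  homOfGraph (rhoGraph K L n) (rhoGraph_total n) (rhoGraph_single n)

end Rho

end

section

variable {C : Type u} [Category.{v} C] [Abelian C]

section ChainLift

/-- A chain map between resolutions together with the morphisms between the syzygies. -/
structure ChainLift (K L : CutResolution C) where
  X : ∀ k, K.X k ⟶ L.X k
  Q : ∀ k, K.Q k ⟶ L.Q k
  comm_π : ∀ k, Q k ≫ L.π k = K.π k ≫ X k
  comm_ι : ∀ k, X (k + 1) ≫ L.ι k = K.ι k ≫ Q k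

theorem ChainLift.comm_d {K L : CutResolution C} (F : ChainLift K L) (k : ℕ) :
    F.Q (k + 1) ≫ L.d k = K.d k ≫ F.Q k := by
  rw [CutResolution.d, CutResolution.d, ← Category.assoc, F.comm_π, Category.assoc, F.comm_ι,
    Category.assoc]

theorem ChainLift.exists_lift (K L : CutResolution C) (f : K.X 0 ⟶ L.X 0) :
    ∃ F : ChainLift K L, F.X 0 = f := by
  have step : ∀ k (x : K.X k ⟶ L.X k), ∃ y : (K.Q k ⟶ L.Q k) × (K.X (k + 1) ⟶ L.X (k + 1)),
      y.1 ≫ L.π k = K.π k ≫ x ∧ y.2 ≫ L.ι k = K.ι k ≫ y.1 := by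
    intro k x
    obtain ⟨f₀, h₀⟩ := L.exists_lift (K.π k ≫ x)
    obtain ⟨f₁, h₁⟩ := L.exists_ker (K.ι k ≫ f₀) (by
      rw [Category.assoc, h₀, ← Category.assoc, K.w, zero_comp])
    exact ⟨(f₀, f₁), h₀, h₁⟩
  choose next hnext using step
  let x : ∀ k, K.X k ⟶ L.X k := fun k => Nat.rec f (fun k x => (next k x).2) k
  exact ⟨⟨x, fun k => (next k (x k)).1, fun k => (hnext k (x k)).1, fun k => (hnext k (x k)).2⟩, rfl⟩

/-- A chosen chain map that lifts a morphism between the resolved objects. -/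
noncomputable def chainLift (K L : CutResolution C) (f : K.X 0 ⟶ L.X 0) : ChainLift K L :=
  (ChainLift.exists_lift K L f).choose

theorem chainLift_X_zero (K L : CutResolution C) (f : K.X 0 ⟶ L.X 0) :
    (chainLift K L f).X 0 = f :=
  (ChainLift.exists_lift K L f).choose_spec

/-- The resolution of the first syzygy that is obtained from `K` by leaving out the term of
degree `0`. -/
def CutResolution.tail (K : CutResolution C) : CutResolution C where
  X k := K.X (k + 1)
  Q k := K.Q (k + 1)
  ι k := K.ι (k + 1)
  π k := K.π (k + 1)
  w k := K.w (k + 1)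
  exact k := K.exact (k + 1)
  proj k := K.proj (k + 1)

end ChainLift

section InducedMaps

variable (K : CutResolution C) {L M : CutResolution C} (F : ChainLift L M)

theorem trans_post (p q : ℕ) (x : Stable (K.X p) (L.X q)) :
    K.trans M p q (Stable.post _ (F.X q) x) = Stable.post _ (F.X (q + 1)) (K.trans L p q x) := by
  obtain ⟨_, f, f₀, f₁, h₀, h₁, h⟩ := K.transGraph_total L p q x
  obtain ⟨rfl, -⟩ := Prod.mk.inj h
  rw [CutResolution.trans_mk f₀ h₀ h₁, Stable.post_mk, Stable.post_mk]
  refine CutResolution.trans_mk (f₀ ≫ F.Q q) ?_ ?_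
  · rw [Category.assoc, F.comm_π, ← Category.assoc, h₀, Category.assoc]
  · rw [Category.assoc, F.comm_ι, ← Category.assoc, h₁, Category.assoc]

/-- The homomorphism between terms of the naive construction induced by the morphisms between the
syzygies. -/
noncomputable def BC.map (n : ℤ) : BC K L n →+ BC K M n :=
  DirLim.lift (fun i => (BC.of K M i).comp (Stable.post _ (F.X i.q))) (fun i x => by
    change BC.of K M i.succ (Stable.post _ (F.X (i.q + 1)) (K.trans L i.p i.q x)) =
      BC.of K M i (Stable.post _ (F.X i.q) x)
    rw [← trans_post, BC.of_trans])

theorem deltaRes_map (p q : ℕ) (x : ExtGrp K p (L.X q)) :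
    deltaRes K M p q (ExtGrp.map K p (F.X q) x) =
      ExtGrp.map K (p + 1) (F.X (q + 1)) (deltaRes K L p q x) := by
  obtain ⟨_, f, e, G, he, hG, h⟩ := deltaGraph_total K (L.exact q) p x
  obtain ⟨rfl, -⟩ := Prod.mk.inj h
  change e ≫ L.π q = f.1 at he
  change G.1 ≫ L.ι q = _ at hG
  rw [deltaRes_mk e he hG]
  refine deltaRes_mk (e ≫ F.Q q) ?_ ?_
  · change _ = f.1 ≫ F.X q
    rw [Category.assoc, F.comm_π, ← Category.assoc, he]
  · change (G.1 ≫ F.X (q + 1)) ≫ _ = _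
    rw [Category.assoc, F.comm_ι, ← Category.assoc, hG, Category.assoc]

/-- The homomorphism between terms of the resolution construction induced by the morphisms between
the syzygies. -/
noncomputable def ExtRes.map (n : ℤ) : ExtRes K L n →+ ExtRes K M n :=
  DirLim.lift (fun i => (ExtRes.of K M i).comp (ExtGrp.map K i.p (F.X i.q))) (fun i x => by
    change ExtRes.of K M i.succ (ExtGrp.map K (i.p + 1) (F.X (i.q + 1)) (deltaRes K L i.p i.q x)) =
      ExtRes.of K M i (ExtGrp.map K i.p (F.X i.q) x)
    rw [← deltaRes_map, ExtRes.of_delta])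

/-- The composition of cochains with a chain map. -/
def Cochain.map (n : ℤ) : Cochain K L n →+ Cochain K M n :=
  AddMonoidHom.mk' (fun φ i => φ i ≫ F.Q i.q) (fun φ ψ => by funext i; simp)

theorem hypD_map {n m : ℤ} (hm : n + 1 = m) (φ : Cochain K L n) (j : Idx m) :
    hypD K M hm (Cochain.map K F n φ) j = hypD K L hm φ j ≫ F.Q j.q := by
  obtain ⟨p, q, h⟩ := j
  cases p with
  | zero =>
    rw [hypD_zero, hypD_zero]
    change (_ ≫ F.Q (q + 1)) ≫ M.d q = _
    rw [Category.assoc, F.comm_d, Category.assoc]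
  | succ p =>
    rw [hypD_succ, hypD_succ]
    change (_ ≫ F.Q (q + 1)) ≫ M.d q - n.negOnePow • K.d p ≫ _ ≫ F.Q q = _
    rw [Category.assoc, F.comm_d, Preadditive.sub_comp, Linear.units_smul_comp, Category.assoc,
      Category.assoc]

theorem Cochain.map_mem_almostHom {n : ℤ} {φ : Cochain K L n} (h : φ ∈ almostHom K L n) :
    Cochain.map K F n φ ∈ almostHom K M n := by
  refine Set.Finite.subset h fun j hj h0 => hj ?_
  rw [hypD_map, h0, zero_comp]

theorem Cochain.map_mem_almostNull {n : ℤ} {φ : Cochain K L n} (h : φ ∈ almostNull K L n) :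
    Cochain.map K F n φ ∈ almostNull K M n := by
  obtain ⟨e, he⟩ := h
  refine ⟨Cochain.map K F (n - 1) e, he.subset fun j hj h0 => hj ?_⟩
  rw [hypD_map, ← h0]
  rfl

/-- The homomorphism between terms of the hypercohomology construction induced by a chain map. -/
def VExt.map (n : ℤ) : VExt K L n →+ VExt K M n :=
  QuotientAddGroup.map _ _
    (((Cochain.map K F n).comp (almostHom K L n).subtype).codRestrict (almostHom K M n)
      fun φ => Cochain.map_mem_almostHom K F φ.2)
    fun _ hφ => Cochain.map_mem_almostNull K F hφ

end InducedMaps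

section Shift

variable (K : CutResolution C) {D B : CutResolution C} (F : ChainLift D.tail B)

/-- The components `h_k : D_{k + 1} ⟶ B_k` of a chain map `D^{+1}_• ⟶ B_•`. -/
def ChainLift.h (F : ChainLift D.tail B) (k : ℕ) : D.Q (k + 1) ⟶ B.Q k := F.Q k

theorem ChainLift.h_d (F : ChainLift D.tail B) (k : ℕ) :
    F.h (k + 1) ≫ B.d k = D.d (k + 1) ≫ F.h k := F.comm_d k

/-- The operator that sends a cochain `φ` of degree `n` to the cochain of degree `n + 1` whose
component with values in `B_k` is `(-1) ^ (k + n) h_k ∘ φ_{n + k + 1}` for the component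
`φ_{n + k + 1}` of `φ` with values in `D_{k + 1}`. -/
def shiftOp {n m : ℤ} (hm : n + 1 = m) : Cochain K D n →+ Cochain K B m :=
  AddMonoidHom.mk' (fun φ j => ((j.q : ℤ) + n).negOnePow •
    φ ⟨j.p, j.q + 1, by have := j.h; push_cast; omega⟩ ≫ F.h j.q) (fun φ ψ => by
      funext j
      simp only [Pi.add_apply, Preadditive.add_comp, smul_add])

theorem shiftOp_apply {n m : ℤ} (hm : n + 1 = m) (φ : Cochain K D n) (p q : ℕ)
    (h : (p : ℤ) = q + m) :
    shiftOp K F hm φ ⟨p, q, h⟩ = ((q : ℤ) + n).negOnePow •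
      φ ⟨p, q + 1, by push_cast; omega⟩ ≫ F.h q := rfl

theorem hypD_shiftOp {n m l : ℤ} (hm : n + 1 = m) (hl : m + 1 = l) (φ : Cochain K D n) :
    hypD K B hl (shiftOp K F hm φ) = shiftOp K F hl (hypD K D hm φ) := by
  have h1 : ∀ q : ℕ, (((q + 1 : ℕ) : ℤ) + n).negOnePow = ((q : ℤ) + m).negOnePow := by
    intro q; congr 1; push_cast; omega
  funext ⟨p, q, h⟩
  cases p with
  | zero =>
    rw [hypD_zero, shiftOp_apply, shiftOp_apply, hypD_zero, Linear.units_smul_comp, Category.assoc,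
      ChainLift.h_d, h1, Category.assoc]
  | succ p =>
    rw [hypD_succ, shiftOp_apply, shiftOp_apply, shiftOp_apply, hypD_succ, Linear.units_smul_comp,
      h1]
    have h2 : m.negOnePow * ((q : ℤ) + n).negOnePow = ((q : ℤ) + m).negOnePow * n.negOnePow := by
      rw [← Int.negOnePow_add, ← Int.negOnePow_add]
      congr 1
      ring
    simp only [Category.assoc, ChainLift.h_d, Preadditive.sub_comp, smul_sub,
      Linear.units_smul_comp, Linear.comp_units_smul, smul_smul, h2]

theorem shiftOp_mem_almostHom {n : ℤ} {φ : Cochain K D n} (h : φ ∈ almostHom K D n) :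
    shiftOp K F rfl φ ∈ almostHom K B (n + 1) := by
  obtain ⟨N, hN⟩ := (Idx.finite_iff _).1 h
  refine (Idx.finite_iff _).2 ⟨N, fun j hj => ?_⟩
  by_contra hlt
  refine hj ?_
  obtain ⟨p, q, hpq⟩ := j
  have : hypD K D rfl φ ⟨p, q + 1, by push_cast; omega⟩ = 0 := by
    by_contra h0
    have := hN _ h0
    dsimp only at this hlt
    omega
  rw [hypD_shiftOp K F rfl rfl, shiftOp_apply, this, zero_comp, smul_zero]

theorem shiftOp_mem_almostNull {n : ℤ} {φ : Cochain K D n} (h : φ ∈ almostNull K D n) :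
    shiftOp K F rfl φ ∈ almostNull K B (n + 1) := by
  obtain ⟨e, he⟩ := h
  obtain ⟨N, hN⟩ := (Idx.finite_iff _).1 he
  refine ⟨shiftOp K F (by ring) e, (Idx.finite_iff _).2 ⟨N, fun j hj => ?_⟩⟩
  by_contra hlt
  refine hj ?_
  obtain ⟨p, q, hpq⟩ := j
  have : φ ⟨p, q + 1, by push_cast; omega⟩ =
      hypD K D (by ring) e ⟨p, q + 1, by push_cast; omega⟩ := by
    by_contra h0
    have := hN _ h0
    dsimp only at this hlt
    omega
  have h3 := hypD_shiftOp K F (n := n - 1) (m := n + 1 - 1) (by ring) (by ring : _ = n + 1) e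
  rw [h3]
  have h4 : ∀ (m : ℤ) (hm : m + 1 = n + 1) (ψ : Cochain K D m) (hmn : m = n),
      (φ ⟨p, q + 1, by push_cast; omega⟩ = ψ ⟨p, q + 1, by push_cast; omega⟩) →
      shiftOp K F rfl φ ⟨p, q, hpq⟩ = shiftOp K F hm ψ ⟨p, q, hpq⟩ := by
    rintro m hm ψ rfl h
    rw [shiftOp_apply, shiftOp_apply, h]
  refine h4 _ _ _ (by ring) (this.trans ?_)
  have h5 : ∀ (m : ℤ) (hm : n - 1 + 1 = m) (hmn : m = n),
      hypD K D (m := n) (by ring) e ⟨p, q + 1, by push_cast; omega⟩ =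
        hypD K D hm e ⟨p, q + 1, by push_cast; omega⟩ := by
    rintro m hm rfl
    rfl
  exact h5 _ _ (by ring)

/-- The homomorphism of the hypercohomology construction that is given by a chain map
`D^{+1}_• ⟶ B_•`, namely the composition with this chain map and with the chain map
`D_• ⟶ D^{+1}[-1]_•` whose components are the identities with the signs `(-1) ^ (k + n)`. -/
def shiftHom (n : ℤ) : VExt K D n →+ VExt K B (n + 1) :=
  QuotientAddGroup.map _ _
    (((shiftOp K F rfl).comp (almostHom K D n).subtype).codRestrict (almostHom K B (n + 1))
      fun φ => shiftOp_mem_almostHom K F φ.2)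
    fun _ hφ => shiftOp_mem_almostNull K F hφ

end Shift

end

section

variable {C : Type u} [Category.{v} C] [Abelian C]

section Horseshoe

/-- A short exact sequence of resolutions, with the short exact sequences of their syzygies. -/
structure ResSeq (K L : CutResolution C) where
  M : CutResolution C
  f : ChainLift K M
  g : ChainLift M L
  wX : ∀ k, f.X k ≫ g.X k = 0
  wQ : ∀ k, f.Q k ≫ g.Q k = 0
  exactX : ∀ k, (ShortComplex.mk (f.X k) (g.X k) (wX k)).ShortExact
  exactQ : ∀ k, (ShortComplex.mk (f.Q k) (g.Q k) (wQ k)).ShortExact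

/-- A short exact sequence of resolutions as provided by the Horseshoe Lemma for `S`. Its first and
third terms are the given resolutions of `S.X₁` and `S.X₃`; the second term is a resolution of
`S.X₂`, by means of the isomorphism `e`. -/
structure Horseshoe {S : ShortComplex C} (R₁ : ProjectiveResolution S.X₁)
    (R₃ : ProjectiveResolution S.X₃) extends ResSeq (cut R₁) (cut R₃) where
  e : M.X 0 ≅ S.X₂
  f_e : f.X 0 ≫ e.hom = S.f
  e_g : e.hom ≫ S.g = g.X 0

/-- A short exact sequence between the `k`-th syzygies. -/
structure SyzRow (K L : CutResolution C) (k : ℕ) where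
  E : C
  a : K.X k ⟶ E
  b : E ⟶ L.X k
  w : a ≫ b = 0
  exact : (ShortComplex.mk a b w).ShortExact

variable {K L : CutResolution C}

/-- The lift of the epimorphism from `Q k` that is used in the Horseshoe Lemma. -/
noncomputable def SyzRow.s {k : ℕ} (r : SyzRow K L k) : L.Q k ⟶ r.E :=
  have : Epi r.b := r.exact.epi_g
  Projective.factorThru (L.π k) r.b

theorem SyzRow.s_b {k : ℕ} (r : SyzRow K L k) : r.s ≫ r.b = L.π k :=
  have : Epi r.b := r.exact.epi_g
  Projective.factorThru_comp _ _

/-- The epimorphism onto the middle term in the Horseshoe Lemma. -/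
noncomputable def SyzRow.π {k : ℕ} (r : SyzRow K L k) : K.Q k ⊞ L.Q k ⟶ r.E :=
  biprod.desc (K.π k ≫ r.a) r.s

theorem SyzRow.π_b {k : ℕ} (r : SyzRow K L k) : r.π ≫ r.b = biprod.snd ≫ L.π k := by
  ext <;> simp [SyzRow.π, r.w, r.s_b]

theorem SyzRow.epi {k : ℕ} (r : SyzRow K L k) : Epi r.π := by
  rw [Preadditive.epi_iff_cancel_zero]
  intro P g hg
  have h1 : r.a ≫ g = 0 := by
    rw [← cancel_epi (K.π k), comp_zero]
    simpa [SyzRow.π] using congrArg (biprod.inl ≫ ·) hg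
  have h2 : r.s ≫ g = 0 := by
    simpa [SyzRow.π] using congrArg (biprod.inr ≫ ·) hg
  obtain ⟨c, h3⟩ : ∃ c : L.X k ⟶ P, r.b ≫ c = g :=
    have : Epi (ShortComplex.mk r.a r.b r.w).g := r.exact.epi_g
    ⟨r.exact.exact.desc g h1, r.exact.exact.g_desc g h1⟩
  have : c = 0 := by
    rw [← cancel_epi (L.π k), comp_zero, ← r.s_b, Category.assoc, h3, h2]
  rw [← h3, this, comp_zero]

/-- The short exact sequence of the next syzygies in the Horseshoe Lemma. -/
theorem SyzRow.exists_next {k : ℕ} (r : SyzRow K L k) :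
    ∃ r' : SyzRow K L (k + 1), ∃ ι : r'.E ⟶ K.Q k ⊞ L.Q k, ∃ w : ι ≫ r.π = 0,
      (ShortComplex.mk ι r.π w).ShortExact ∧ r'.a ≫ ι = K.ι k ≫ biprod.inl ∧
        r'.b ≫ L.ι k = ι ≫ biprod.snd := by
  have := r.epi
  have : Mono r.a := r.exact.mono_f
  let a : K.X (k + 1) ⟶ kernel r.π := kernel.lift _ (K.ι k ≫ biprod.inl) (by
    rw [Category.assoc, SyzRow.π, biprod.inl_desc, ← Category.assoc, K.w, zero_comp])
  have ha : a ≫ kernel.ι r.π = K.ι k ≫ biprod.inl := kernel.lift_ι _ _ _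
  obtain ⟨b, hb⟩ := L.exists_ker (kernel.ι r.π ≫ biprod.snd) (by
    rw [Category.assoc, ← r.π_b, ← Category.assoc, kernel.condition, zero_comp])
  have hab : a ≫ b = 0 := by
    rw [← cancel_mono (L.ι k), Category.assoc, hb, ← Category.assoc, ha]
    simp
  have hmono : Mono a := by
    have : Mono (a ≫ kernel.ι r.π) := ha ▸ mono_comp _ _
    exact mono_of_mono a (kernel.ι r.π)
  have hepi : Epi b := by
    refine (epi_iff_surjective_up_to_refinements b).2 fun {T} y => ?_
    obtain ⟨z, hz⟩ := r.exact.exact.lift' (y ≫ L.ι k ≫ r.s) (by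
      change _ ≫ r.b = 0
      rw [Category.assoc, Category.assoc, r.s_b, L.w, comp_zero])
    change T ⟶ K.X k at z
    change z ≫ r.a = _ at hz
    obtain ⟨T', c, hc, z', hz'⟩ := surjective_up_to_refinements_of_epi (K.π k) z
    have hx : biprod.lift (-z') (c ≫ y ≫ L.ι k) ≫ r.π = 0 := by
      rw [SyzRow.π, biprod.lift_desc, Preadditive.neg_comp, ← Category.assoc, ← hz', Category.assoc,
        hz]
      simp
    refine ⟨T', c, hc, kernel.lift _ _ hx, ?_⟩
    rw [← cancel_mono (L.ι k), Category.assoc, Category.assoc, hb, kernel.lift_ι_assoc,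
      biprod.lift_snd]
  have hex : (ShortComplex.mk a b hab).Exact := by
    refine ShortComplex.exact_of_f_is_kernel _ (KernelFork.IsLimit.ofι' _ _ fun {T} t ht => ?_)
    have h1 : t ≫ kernel.ι r.π = (t ≫ kernel.ι r.π ≫ biprod.fst) ≫ biprod.inl := by
      ext
      · simp
      · have := congrArg (· ≫ L.ι k) ht
        simpa [hb] using this
    have h2 : (t ≫ kernel.ι r.π ≫ biprod.fst) ≫ K.π k = 0 := by
      rw [← cancel_mono r.a, zero_comp]
      have h3 := congrArg (· ≫ r.π) h1
      simp only [Category.assoc, kernel.condition, comp_zero] at h3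
      rw [Category.assoc, Category.assoc, Category.assoc]
      simpa [SyzRow.π] using h3.symm
    have h4 := (K.exists_ker _ h2).choose_spec
    set c := (K.exists_ker _ h2).choose
    refine ⟨c, ?_⟩
    rw [← cancel_mono (kernel.ι r.π), Category.assoc]
    change _ ≫ a ≫ kernel.ι r.π = _
    rw [ha, h1, ← h4, Category.assoc]
  exact ⟨⟨_, a, b, hab, { exact := hex, mono_f := hmono, epi_g := hepi }⟩, kernel.ι r.π,
    kernel.condition _,
    { exact := ShortComplex.exact_kernel _
      mono_f := inferInstanceAs (Mono (kernel.ι r.π))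
      epi_g := r.epi }, ha, hb⟩

theorem ResSeq.exists_of_row (r : SyzRow K L 0) : ∃ (T : ResSeq K L) (e : T.M.X 0 ≅ r.E),
    T.f.X 0 ≫ e.hom = r.a ∧ e.hom ≫ r.b = T.g.X 0 := by
  choose next ι w hex ha hb using fun k => SyzRow.exists_next (K := K) (L := L) (k := k)
  let R : ∀ k, SyzRow K L k := fun k => Nat.rec r (fun k x => next k x) k
  refine ⟨{
    M :=
      { X := fun k => (R k).E
        Q := fun k => K.Q k ⊞ L.Q k
        ι := fun k => ι k (R k)
        π := fun k => (R k).π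
        w := fun k => w k (R k)
        exact := fun k => hex k (R k)
        proj := fun k => inferInstance }
    f :=
      { X := fun k => (R k).a
        Q := fun k => biprod.inl
        comm_π := fun k => by simp [SyzRow.π]
        comm_ι := fun k => ha k (R k) }
    g :=
      { X := fun k => (R k).b
        Q := fun k => biprod.snd
        comm_π := fun k => (R k).π_b.symm
        comm_ι := fun k => hb k (R k) }
    wX := fun k => (R k).w
    wQ := fun k => biprod.inl_snd
    exactX := fun k => (R k).exact
    exactQ := fun k => (ShortComplex.Splitting.ofHasBinaryBiproduct _ _).shortExact }, Iso.refl _,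
      Category.comp_id _, Category.id_comp _⟩

/-- The Horseshoe Lemma. -/
theorem Horseshoe.nonempty {S : ShortComplex C} (hS : S.ShortExact)
    (R₁ : ProjectiveResolution S.X₁) (R₃ : ProjectiveResolution S.X₃) :
    Nonempty (Horseshoe R₁ R₃) := by
  obtain ⟨T, e, h, h'⟩ := ResSeq.exists_of_row (K := cut R₁) (L := cut R₃)
    ⟨S.X₂, S.f, S.g, S.zero, hS⟩
  exact ⟨{ T with e := e, f_e := h, e_g := h' }⟩

end Horseshoe

end

section

variable {C : Type u} [Category.{v} C] [Abelian C]

section Star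

theorem exists_star {S : ShortComplex C} (hS : S.ShortExact) {Q Y : C} [Projective Q] (ι : Y ⟶ Q)
    (π : Q ⟶ S.X₃) (w : ι ≫ π = 0) :
    ∃ s : Y ⟶ S.X₁, ∃ h : Q ⟶ S.X₂, h ≫ S.g = π ∧ s ≫ S.f = ι ≫ h := by
  have := hS.mono_f
  have := hS.epi_g
  have hh : Projective.factorThru π S.g ≫ S.g = π := Projective.factorThru_comp _ _
  obtain ⟨s, hs⟩ := hS.exact.lift' (ι ≫ Projective.factorThru π S.g) (by
    rw [Category.assoc, hh, w])
  exact ⟨s, _, hh, hs⟩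

/-- A chosen morphism `h^*` that fits into a commutative diagram
```
0 ⟶  Y   ⟶  Q   ⟶ S.X₃ ⟶ 0
     | h^*   |       | id
0 ⟶ S.X₁ ⟶ S.X₂ ⟶ S.X₃ ⟶ 0
```
for a projective object `Q`. -/
noncomputable def star {S : ShortComplex C} (hS : S.ShortExact) {Q Y : C} [Projective Q]
    (ι : Y ⟶ Q) (π : Q ⟶ S.X₃) (w : ι ≫ π = 0) : Y ⟶ S.X₁ :=
  (exists_star hS ι π w).choose

theorem star_spec {S : ShortComplex C} (hS : S.ShortExact) {Q Y : C} [Projective Q]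
    (ι : Y ⟶ Q) (π : Q ⟶ S.X₃) (w : ι ≫ π = 0) :
    ∃ h : Q ⟶ S.X₂, h ≫ S.g = π ∧ star hS ι π w ≫ S.f = ι ≫ h :=
  (exists_star hS ι π w).choose_spec

end Star

section Connecting

variable (K : CutResolution C) {B D : CutResolution C} (T : ResSeq B D)

/-- The morphism `h^*` from the `(q + 1)`-st syzygy of `D` to the `q`-th syzygy of `B`. -/
noncomputable def ResSeq.star (q : ℕ) : D.X (q + 1) ⟶ B.X q :=
  CompleteExt.star (T.exactX q) (D.ι q) (D.π q) (D.w q)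

theorem ResSeq.star_spec (q : ℕ) : ∃ h : D.Q q ⟶ T.M.X q,
    h ≫ T.g.X q = D.π q ∧ T.star q ≫ T.f.X q = D.ι q ≫ h :=
  CompleteExt.star_spec (T.exactX q) (D.ι q) (D.π q) (D.w q)

/-- The homomorphism `τ_{p, q}` from `[X p, D_q]` to `[X (p + 1), B_q]`, where `D_q` and `B_q` are
the `q`-th syzygies. It is the transition homomorphism `t` followed by `[X (p + 1), h^*]`. -/
noncomputable def tauLevel (p q : ℕ) : Stable (K.X p) (D.X q) →+ Stable (K.X (p + 1)) (B.X q) :=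
  (Stable.post _ (T.star q)).comp (K.trans D p q)

theorem tauLevel_mk {p q : ℕ} {f : K.X p ⟶ D.X q} (f₀ : K.Q p ⟶ T.M.X q)
    {f₁ : K.X (p + 1) ⟶ B.X q} (h₀ : f₀ ≫ T.g.X q = K.π p ≫ f)
    (h₁ : f₁ ≫ T.f.X q = K.ι p ≫ f₀) : tauLevel K T p q (Stable.mk f) = Stable.mk f₁ := by
  obtain ⟨_, f', a, b, ha, hb, h⟩ := K.transGraph_total D p q (Stable.mk f)
  obtain ⟨hf, -⟩ := Prod.mk.inj h
  obtain ⟨s, hs, hs'⟩ := T.star_spec q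
  have : Mono (T.f.X q) := (T.exactX q).mono_f
  obtain ⟨a, ha⟩ := D.exists_lift (K.π p ≫ f)
  obtain ⟨b, hb⟩ := D.exists_ker (K.ι p ≫ a) (by
    rw [Category.assoc, ha, ← Category.assoc, K.w, zero_comp])
  change Stable.post _ (T.star q) (K.trans D p q (Stable.mk f)) = _
  rw [CutResolution.trans_mk a ha hb, Stable.post_mk]
  obtain ⟨c, hc⟩ := (T.exactX q).exact.lift' (a ≫ s - f₀) (by
    change _ ≫ T.g.X q = 0
    rw [Preadditive.sub_comp, Category.assoc, hs, ha, h₀, sub_self])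
  change K.Q p ⟶ B.X q at c
  change c ≫ T.f.X q = _ at hc
  rw [← sub_eq_zero]
  refine Stable.mk_eq_zero.2 ⟨K.Q p, inferInstance, K.ι p, c, ?_⟩
  rw [← cancel_mono (T.f.X q), Category.assoc, hc, Preadditive.comp_sub, Preadditive.sub_comp, h₁,
    Category.assoc, hs', ← Category.assoc, ← hb, Category.assoc]

/-- The construction underlying the anticommutativity of the connecting homomorphisms with the
transition homomorphisms. -/
theorem ResSeq.exists_anticomm {Y Y' Q' : C} [Projective Y] [Projective Q'] {q : ℕ}
    (x : Y ⟶ T.M.X q) (ι : Y' ⟶ Y) (f₁ : Y' ⟶ B.X q) (h₁ : f₁ ≫ T.f.X q = ι ≫ x)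
    (G₀ : Q' ⟶ B.Q q) (π : Q' ⟶ Y') (hG₀ : G₀ ≫ B.π q = π ≫ f₁) :
    ∃ (F₀ : Y ⟶ T.M.Q q) (z : Q' ⟶ T.M.X (q + 1)), F₀ ≫ T.M.π q = x ∧
      z ≫ T.M.ι q = π ≫ ι ≫ F₀ - G₀ ≫ T.f.Q q := by
  obtain ⟨F₀, hF₀⟩ := T.M.exists_lift x
  obtain ⟨z, hz⟩ := T.M.exists_ker (π ≫ ι ≫ F₀ - G₀ ≫ T.f.Q q) (by
    rw [Preadditive.sub_comp, Category.assoc, Category.assoc, hF₀, Category.assoc, T.f.comm_π,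
      ← Category.assoc G₀, hG₀, Category.assoc, h₁, sub_self])
  exact ⟨F₀, z, hF₀, hz⟩

theorem trans_tauLevel (p q : ℕ) (x : Stable (K.X p) (D.X q)) :
    K.trans B (p + 1) q (tauLevel K T p q x) =
      -tauLevel K T (p + 1) (q + 1) (K.trans D p q x) := by
  obtain ⟨f, rfl⟩ := QuotientAddGroup.mk_surjective x
  have hmono : Mono (T.f.X q) := (T.exactX q).mono_f
  have hepi : Epi (T.g.X q) := (T.exactX q).epi_g
  obtain ⟨f₀, h₀⟩ : ∃ f₀, f₀ ≫ T.g.X q = K.π p ≫ f :=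
    ⟨Projective.factorThru _ _, Projective.factorThru_comp _ _⟩
  obtain ⟨f₁, h₁⟩ := (T.exactX q).exact.lift' (K.ι p ≫ f₀) (by
    change _ ≫ T.g.X q = 0
    rw [Category.assoc, h₀, ← Category.assoc, K.w, zero_comp])
  change K.X (p + 1) ⟶ B.X q at f₁
  change f₁ ≫ T.f.X q = _ at h₁
  obtain ⟨G₀, hG₀⟩ := B.exists_lift (K.π (p + 1) ≫ f₁)
  obtain ⟨G₁, hG₁⟩ := B.exists_ker (K.ι (p + 1) ≫ G₀) (by
    rw [Category.assoc, hG₀, ← Category.assoc, K.w, zero_comp])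
  obtain ⟨F₀, z, hF₀, hz⟩ := T.exists_anticomm f₀ (K.ι p) f₁ h₁ G₀ (K.π (p + 1)) hG₀
  have hf : (F₀ ≫ T.g.Q q) ≫ D.π q = K.π p ≫ f := by
    rw [Category.assoc, T.g.comm_π, ← Category.assoc, hF₀, h₀]
  obtain ⟨f', hf'⟩ := D.exists_ker (K.ι p ≫ F₀ ≫ T.g.Q q) (by
    rw [Category.assoc, hf, ← Category.assoc, K.w, zero_comp])
  change K.trans B (p + 1) q (tauLevel K T p q (Stable.mk f)) =
      -tauLevel K T (p + 1) (q + 1) (K.trans D p q (Stable.mk f))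
  rw [tauLevel_mk K T f₀ h₀ h₁, CutResolution.trans_mk G₀ hG₀ hG₁, CutResolution.trans_mk _ hf hf',
    tauLevel_mk K T z (f₁ := -G₁), eq_neg_iff_add_eq_zero]
  · exact (add_neg_cancel (Stable.mk G₁) :)
  · rw [← cancel_mono (D.ι q), Category.assoc, T.g.comm_ι, ← Category.assoc, hz,
      Category.assoc, hf', Preadditive.sub_comp, Category.assoc, Category.assoc, Category.assoc,
      T.wQ, comp_zero, sub_zero]
  · rw [← cancel_mono (T.M.ι q), Category.assoc, T.f.comm_ι, Category.assoc, hz,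
      Preadditive.comp_sub, ← Category.assoc (K.ι (p + 1)) (K.π (p + 1)), K.w, zero_comp, zero_sub,
      Preadditive.neg_comp, ← Category.assoc, hG₁, Category.assoc]

/-- The connecting homomorphism `τ^n` of the naive construction, the direct limit of the
homomorphisms `(-1) ^ q τ_{p, q}`. -/
noncomputable def tauHom (n : ℤ) : BC K D n →+ BC K B (n + 1) :=
  DirLim.lift (fun i => (BC.of K B i.up).comp ((i.q : ℤ).negOnePow • tauLevel K T i.p i.q))
    (fun i x => by
      change BC.of K B i.succ.up (((i.q + 1 : ℕ) : ℤ).negOnePow •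
        tauLevel K T (i.p + 1) (i.q + 1) (K.trans D i.p i.q x)) =
        BC.of K B i.up ((i.q : ℤ).negOnePow • tauLevel K T i.p i.q x)
      have h : K.trans B (i.p + 1) i.q ((i.q : ℤ).negOnePow • tauLevel K T i.p i.q x) =
          ((i.q + 1 : ℕ) : ℤ).negOnePow •
            tauLevel K T (i.p + 1) (i.q + 1) (K.trans D i.p i.q x) := by
        rw [map_zsmul_unit, trans_tauLevel]
        push_cast
        rw [Int.negOnePow_succ, Units.neg_smul, smul_neg]
      rw [← h]
      exact BC.of_trans K B i.up _)

/-- The connecting homomorphism from `Ext^p(A, D_q)` to `Ext^{p + 1}(A, B_q)`, where `D_q` and `B_q`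
are the `q`-th syzygies. -/
noncomputable def deltaRow (p q : ℕ) : ExtGrp K p (D.X q) →+ ExtGrp K (p + 1) (B.X q) :=
  delta K (T.exactX q) p

theorem deltaRow_mk {p q : ℕ} {f : cocycles K p (D.X q)} (e : K.Q p ⟶ T.M.X q)
    {F : cocycles K (p + 1) (B.X q)} (he : e ≫ T.g.X q = f.1) (hF : F.1 ≫ T.f.X q = K.d p ≫ e) :
    deltaRow K T p q (ExtGrp.mk f) = ExtGrp.mk F :=
  delta_mk (T.exactX q) e he hF

theorem deltaRes_deltaRow (p q : ℕ) (x : ExtGrp K p (D.X q)) :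
    deltaRes K B (p + 1) q (deltaRow K T p q x) =
      -deltaRow K T (p + 1) (q + 1) (deltaRes K D p q x) := by
  obtain ⟨_, f, e, F, he, hF, h⟩ := deltaGraph_total K (T.exactX q) p x
  obtain ⟨rfl, -⟩ := Prod.mk.inj h
  change e ≫ T.g.X q = f.1 at he
  change F.1 ≫ T.f.X q = K.d p ≫ e at hF
  have hf : K.d p ≫ f.1 = 0 := f.2
  have hF' : K.d (p + 1) ≫ F.1 = 0 := F.2
  obtain ⟨G₀, hG₀⟩ := B.exists_lift F.1
  obtain ⟨G₁, hG₁⟩ := B.exists_ker (K.d (p + 1) ≫ G₀) (by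
    rw [Category.assoc, hG₀, hF'])
  obtain ⟨F₀, z, hF₀, hz⟩ := T.exists_anticomm e (K.d p) F.1 hF G₀ (𝟙 _)
    (hG₀.trans (Category.id_comp _).symm)
  rw [Category.id_comp] at hz
  have hf0 : (F₀ ≫ T.g.Q q) ≫ D.π q = f.1 := by
    rw [Category.assoc, T.g.comm_π, ← Category.assoc, hF₀, he]
  obtain ⟨f', hf'⟩ := D.exists_ker (K.d p ≫ F₀ ≫ T.g.Q q) (by
    rw [Category.assoc, hf0, hf])
  have hfc : f' ∈ cocycles K (p + 1) (D.X (q + 1)) := by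
    change K.d (p + 1) ≫ f' = 0
    rw [← cancel_mono (D.ι q), Category.assoc, hf', ← Category.assoc, K.d_d, zero_comp, zero_comp]
  have hGc : G₁ ∈ cocycles K (p + 1 + 1) (B.X (q + 1)) := by
    change K.d (p + 1 + 1) ≫ G₁ = 0
    rw [← cancel_mono (B.ι q), Category.assoc, hG₁, ← Category.assoc, K.d_d, zero_comp, zero_comp]
  rw [deltaRow_mk K T e he hF, deltaRes_mk (F := ⟨G₁, hGc⟩) G₀ hG₀ hG₁,
    deltaRes_mk (F := ⟨f', hfc⟩) _ hf0 hf',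
    deltaRow_mk K T z (F := -⟨G₁, hGc⟩), eq_neg_iff_add_eq_zero]
  · exact (add_neg_cancel (ExtGrp.mk ⟨G₁, hGc⟩) :)
  · change z ≫ _ = f'
    rw [← cancel_mono (D.ι q), Category.assoc, T.g.comm_ι, ← Category.assoc, hz, hf',
      Preadditive.sub_comp, Category.assoc, Category.assoc, T.wQ, comp_zero, sub_zero]
  · change (-G₁) ≫ _ = _
    rw [← cancel_mono (T.M.ι q), Category.assoc, T.f.comm_ι, Category.assoc, hz,
      Preadditive.comp_sub, ← Category.assoc (K.d (p + 1)) (K.d p), K.d_d, zero_comp, zero_sub,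
      Preadditive.neg_comp, ← Category.assoc, hG₁, Category.assoc]

/-- The connecting homomorphism of the resolution construction, the direct limit of the connecting
homomorphisms with the signs `(-1) ^ q`. -/
noncomputable def deltaHom (n : ℤ) : ExtRes K D n →+ ExtRes K B (n + 1) :=
  DirLim.lift (fun i => (ExtRes.of K B i.up).comp ((i.q : ℤ).negOnePow • deltaRow K T i.p i.q))
    (fun i x => by
      change ExtRes.of K B i.succ.up (((i.q + 1 : ℕ) : ℤ).negOnePow •
        deltaRow K T (i.p + 1) (i.q + 1) (deltaRes K D i.p i.q x)) =
        ExtRes.of K B i.up ((i.q : ℤ).negOnePow • deltaRow K T i.p i.q x)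
      have h : deltaRes K B (i.p + 1) i.q ((i.q : ℤ).negOnePow • deltaRow K T i.p i.q x) =
          ((i.q + 1 : ℕ) : ℤ).negOnePow •
            deltaRow K T (i.p + 1) (i.q + 1) (deltaRes K D i.p i.q x) := by
        rw [map_zsmul_unit, deltaRes_deltaRow]
        push_cast
        rw [Int.negOnePow_succ, Units.neg_smul]
        exact zsmul_neg _ _
      rw [← h]
      exact ExtRes.of_delta K B i.up _)

end Connecting

end

section

section CohomologicalFunctor

/-- The data of a cohomological functor from `C` to `D`: the values `T^n(X)`, the induced morphisms
`T^n(f)` and the connecting morphisms. -/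
structure CohData (C : Type*) [Category* C] [Abelian C] (D : Type*) [Category* D] [Abelian D] where
  obj : ℤ → C → D
  map : ∀ (n : ℤ) {X Y : C}, (X ⟶ Y) → (obj n X ⟶ obj n Y)
  δ : ∀ (n : ℤ) {S : ShortComplex C}, S.ShortExact → (obj n S.X₃ ⟶ obj (n + 1) S.X₁)

variable {C : Type*} [Category* C] [Abelian C] {D : Type*} [Category* D] [Abelian D]

/-- The axioms of a cohomological functor: every `T^n` is an additive functor, the connecting
morphisms are natural, and there are long exact sequences. -/
structure IsCohomologicalFunctor (T : CohData C D) : Prop where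
  map_id : ∀ (n : ℤ) (X : C), T.map n (𝟙 X) = 𝟙 (T.obj n X)
  map_comp : ∀ (n : ℤ) {X Y Z : C} (f : X ⟶ Y) (g : Y ⟶ Z),
    T.map n (f ≫ g) = T.map n f ≫ T.map n g
  map_add : ∀ (n : ℤ) {X Y : C} (f g : X ⟶ Y), T.map n (f + g) = T.map n f + T.map n g
  δ_natural : ∀ (n : ℤ) {S S' : ShortComplex C} (hS : S.ShortExact) (hS' : S'.ShortExact)
    (φ : S ⟶ S'), T.δ n hS ≫ T.map (n + 1) φ.τ₁ = T.map n φ.τ₃ ≫ T.δ n hS'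
  exact₁ : ∀ (n : ℤ) {S : ShortComplex C} (hS : S.ShortExact),
    ∃ w : T.δ n hS ≫ T.map (n + 1) S.f = 0, (ShortComplex.mk _ _ w).Exact
  exact₂ : ∀ (n : ℤ) {S : ShortComplex C}, S.ShortExact →
    ∃ w : T.map n S.f ≫ T.map n S.g = 0, (ShortComplex.mk _ _ w).Exact
  exact₃ : ∀ (n : ℤ) {S : ShortComplex C} (hS : S.ShortExact),
    ∃ w : T.map n S.g ≫ T.δ n hS = 0, (ShortComplex.mk _ _ w).Exact

/-- The axioms of an isomorphism of cohomological functors: a family of natural isomorphisms that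
commute with the connecting morphisms. -/
structure IsCohomologicalIso (T U : CohData C D) (ν : ∀ (n : ℤ) (X : C), T.obj n X ⟶ U.obj n X) :
    Prop where
  natural : ∀ (n : ℤ) {X Y : C} (f : X ⟶ Y), T.map n f ≫ ν n Y = ν n X ≫ U.map n f
  comm_δ : ∀ (n : ℤ) {S : ShortComplex C} (hS : S.ShortExact),
    T.δ n hS ≫ ν (n + 1) S.X₁ = ν n S.X₃ ≫ U.δ n hS
  isIso : ∀ (n : ℤ) (X : C), IsIso (ν n X)

end CohomologicalFunctor

section Constructions

variable {C : Type u} [Category.{v} C] [Abelian C] (P : ∀ X : C, ProjectiveResolution X)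

/-- A chain map between the chosen projective resolutions lifting `f`, together with the morphisms
between the syzygies. -/
noncomputable def resLift {X Y : C} (f : X ⟶ Y) : ChainLift (cut (P X)) (cut (P Y)) :=
  chainLift (cut (P X)) (cut (P Y)) f

/-- For a short exact sequence `0 ⟶ B ⟶ C ⟶ D ⟶ 0`, a chain map `D^{+1}_• ⟶ B_•` lifting a
morphism `h^*` from the first syzygy of `D` to `B` that is itself a lift of the identity of `D`. -/
noncomputable def starLift {S : ShortComplex C} (hS : S.ShortExact) :
    ChainLift (cut (P S.X₃)).tail (cut (P S.X₁)) :=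
  chainLift (cut (P S.X₃)).tail (cut (P S.X₁))
    (star hS ((cut (P S.X₃)).ι 0) ((cut (P S.X₃)).π 0) ((cut (P S.X₃)).w 0))

/-- The hypercohomology construction. -/
noncomputable def hyper (A : C) : CohData C AddCommGrpCat.{v} where
  obj n B := AddCommGrpCat.of (VExt (cut (P A)) (cut (P B)) n)
  map n _ _ f := AddCommGrpCat.ofHom (VExt.map (cut (P A)) (resLift P f) n)
  δ n _ hS := AddCommGrpCat.ofHom (shiftHom (cut (P A)) (starLift P hS) n)

variable (H : ∀ S : ShortComplex C, S.ShortExact → Horseshoe (P S.X₁) (P S.X₃))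

/-- The resolution construction. -/
noncomputable def extRes (A : C) : CohData C AddCommGrpCat.{v} where
  obj n B := AddCommGrpCat.of (ExtRes (cut (P A)) (cut (P B)) n)
  map n _ _ f := AddCommGrpCat.ofHom (ExtRes.map (cut (P A)) (resLift P f) n)
  δ n S hS := AddCommGrpCat.ofHom (deltaHom (cut (P A)) (H S hS).toResSeq n)

/-- The naive construction. -/
noncomputable def naive (A : C) : CohData C AddCommGrpCat.{v} where
  obj n B := AddCommGrpCat.of (BC (cut (P A)) (cut (P B)) n)
  map n _ _ f := AddCommGrpCat.ofHom (BC.map (cut (P A)) (resLift P f) n)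
  δ n S hS := AddCommGrpCat.ofHom (tauHom (cut (P A)) (H S hS).toResSeq n)

/-- The homomorphisms `σ^n` from the resolution to the hypercohomology construction. -/
noncomputable def sigma (A : C) (n : ℤ) (B : C) : (extRes P H A).obj n B ⟶ (hyper P A).obj n B :=
  AddCommGrpCat.ofHom (sigmaHom (cut (P A)) (cut (P B)) n)

/-- The homomorphisms `β^n` from the resolution to the naive construction. -/
noncomputable def beta (A : C) (n : ℤ) (B : C) : (extRes P H A).obj n B ⟶ (naive P H A).obj n B :=
  AddCommGrpCat.ofHom (betaHom (cut (P A)) (cut (P B)) n)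

/-- The homomorphisms `ρ^n` from the hypercohomology to the naive construction. -/
noncomputable def rho (A : C) (n : ℤ) (B : C) : (hyper P A).obj n B ⟶ (naive P H A).obj n B :=
  AddCommGrpCat.ofHom (rhoHom (cut (P A)) (cut (P B)) n)

end Constructions

end

end CompleteExt

/-!
All three constructions are compared with the naive one, where computations are easy because the
group `[X, Y]` forgets every choice of a lift: two chain maps between resolutions that agree in
degree zero up to a morphism through a projective object agree stably on all syzygies
(`ChainLift.mk_X_eq`).

The functor axioms and the naturality of the connecting homomorphism `τ` are immediate from this for
the naive construction, once `τ` is expressed by one chain map `h : D^{+1}_• ⟶ B_•`. The morphisms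
`h^*_q` of the sequences of syzygies agree stably with `(-1) ^ q h_q`, so that the sign in the
definition of `τ` disappears (`ResSeq.mk_star`, `tauHom_of`). Here the resolution of the middle term
given by the Horseshoe Lemma may be replaced by the chosen one (`Horseshoe.exists_compare`). The
long exact sequence is proved on representatives: an element of the direct limit vanishes only if
finitely many transition homomorphisms annihilate its representative
(`DirLim.induction_of_eq_zero`), and if a morphism `X p ⟶ X q` factors through a projective object,
then the induced morphism between the next syzygies extends to the `p`-th term of the resolution
(`exists_ι_comp_eq`), which makes the required factorizations possible one step later.

The homomorphism `β` is bijective since the connecting homomorphisms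
`Ext^p(A, X q) ⟶ Ext^{p + 1}(A, X (q + 1))` factor through `[X p, X q]` (`gammaLevel`), so that the
two direct systems are interleaved. On representatives `ρ ∘ σ = β` (`rhoHom_sigmaHom`), and `σ` is
surjective since an almost chain map agrees in high degrees with a lift of the morphism that it
induces on a syzygy. Hence `σ` and `ρ` are bijective as well. That `β` and `ρ` commute with all
structure maps is checked on representatives (`SyzygyRel.shift` for the connecting homomorphism of
the hypercohomology construction); for `σ` it follows. Finally the axioms of a cohomological functor
are transported along `β` and `ρ` (`IsCohomologicalFunctor.of_iso`).
-/

namespace CompleteExt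

/-! ### Elements of direct limits -/

section DirLimElements

/-- The property of an element of a term of a direct system that finitely many transition
homomorphisms send it to zero. -/
inductive DirLim.Dies {I : Type} {s : I → I} {G : I → Type v} [∀ i, AddCommGroup (G i)]
    (t : ∀ i, G i →+ G (s i)) : ∀ i, G i → Prop
  | zero (i : I) : Dies t i 0
  | step (i : I) (x : G i) : Dies t (s i) (t i x) → Dies t i x

variable {n : ℤ} {G : Idx n → Type v} [∀ i, AddCommGroup (G i)]
  {t : ∀ i : Idx n, G i →+ G i.succ}

theorem DirLim.exists_of_add (i : Idx n) (x : G i) (k : ℕ) :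
    ∃ y : G (i.add k), (of i x : DirLim Idx.succ G t) = of (i.add k) y := by
  induction k with
  | zero => exact ⟨x, rfl⟩
  | succ k ih =>
    obtain ⟨y, hy⟩ := ih
    exact ⟨t _ y, hy.trans (of_trans (t := t) (i.add k) y).symm⟩

theorem DirLim.exists_of_of_le {i j : Idx n} (h : i.q ≤ j.q) (x : G i) :
    ∃ y : G j, (of i x : DirLim Idx.succ G t) = of j y := by
  obtain ⟨k, rfl⟩ := Idx.exists_add h
  exact exists_of_add i x k

/-- Every element of the direct limit is represented in arbitrarily high degree. -/
theorem DirLim.exists_of (x : DirLim Idx.succ G t) (N : ℕ) :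
    ∃ i : Idx n, Even i.q ∧ N ≤ i.q ∧ N < i.p ∧ ∃ y : G i, x = of i y := by
  classical
  suffices h : ∃ (i : Idx n) (y : G i), x = of i y by
    obtain ⟨i, y, rfl⟩ := h
    obtain ⟨j, hj, hj', hj''⟩ := Idx.exists_even n (max N i.q)
    obtain ⟨z, hz⟩ := exists_of_of_le (t := t) ((le_max_right _ _).trans hj') y
    exact ⟨j, hj, (le_max_left _ _).trans hj', (le_max_left _ _).trans_lt hj'', z, hz⟩
  obtain ⟨x, rfl⟩ := QuotientAddGroup.mk_surjective x
  induction x using DirectSum.induction_on with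
  | zero =>
    obtain ⟨i, -⟩ := Idx.exists_even n 0
    exact ⟨i, 0, by rw [map_zero]; rfl⟩
  | of i x => exact ⟨i, x, by unfold DirLim.of; congr!⟩
  | add x y hx hy =>
    obtain ⟨i, a, ha⟩ := hx
    obtain ⟨j, b, hb⟩ := hy
    rw [QuotientAddGroup.mk_add]
    change ∃ i y, (_ + _ : DirLim Idx.succ G t) = _
    rcases le_total i.q j.q with h | h
    · obtain ⟨c, hc⟩ := exists_of_of_le (t := t) h a
      exact ⟨j, c + b, by rw [map_add, ← hc, ← ha, ← hb]⟩
    · obtain ⟨c, hc⟩ := exists_of_of_le (t := t) h b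
      exact ⟨i, a + c, by rw [map_add, ← hc, ← ha, ← hb]⟩

variable (G) in
/-- The families of elements of a direct system that vanish in high degrees. -/
def eventuallyZero : AddSubgroup (∀ i, G i) where
  carrier := {ξ | ∃ N, ∀ j : Idx n, N ≤ j.q → ξ j = 0}
  zero_mem' := ⟨0, fun _ _ => rfl⟩
  add_mem' := by
    rintro ξ η ⟨N, hN⟩ ⟨M, hM⟩
    exact ⟨max N M, fun j hj => by
      rw [Pi.add_apply, hN j ((le_max_left _ _).trans hj), hM j ((le_max_right _ _).trans hj),
        add_zero]⟩
  neg_mem' := by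
    rintro ξ ⟨N, hN⟩
    exact ⟨N, fun j hj => by rw [Pi.neg_apply, hN j hj, neg_zero]⟩

/-- The graph of the homomorphism that sends an element of a term of a direct system to the germ
of the family of its images under the transition homomorphisms. -/
def germGraph (t : ∀ i : Idx n, G i →+ G i.succ) (i : Idx n) :
    AddSubgroup (G i × ((∀ j, G j) ⧸ eventuallyZero G)) where
  carrier := {x | ∃ ξ : ∀ j, G j, (∀ k, ξ (i.add k).succ = t _ (ξ (i.add k))) ∧
    x = (ξ i, QuotientAddGroup.mk ξ)}
  zero_mem' := ⟨0, fun _ => (map_zero _).symm, rfl⟩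
  add_mem' := by
    rintro _ _ ⟨ξ, h, rfl⟩ ⟨η, k, rfl⟩
    exact ⟨ξ + η, fun l => by simp only [Pi.add_apply, h, k, map_add], rfl⟩
  neg_mem' := by
    rintro _ ⟨ξ, h, rfl⟩
    exact ⟨-ξ, fun l => by simp only [Pi.neg_apply, h, map_neg], rfl⟩

theorem germGraph_total (i : Idx n) (x : G i) : ∃ y, (x, y) ∈ germGraph t i := by
  -- The family of the images of `x`, extended by zero to the indices below `i`.
  let y : ∀ k, G (i.add k) := fun k => Nat.rec (motive := fun k => G (i.add k)) x
    (fun k z => t (i.add k) z) k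
  obtain ⟨ξ, hξ, -⟩ := Idx.exists_extend i.add_injective y
  refine ⟨QuotientAddGroup.mk ξ, ξ, fun k => ?_, ?_⟩
  · rw [hξ k]
    exact hξ (k + 1)
  · rw [show ξ i = x from hξ 0]

theorem germGraph_single (i : Idx n) (y) (h : (0, y) ∈ germGraph t i) : y = 0 := by
  obtain ⟨ξ, hξ, h⟩ := h
  obtain ⟨h0, rfl⟩ := Prod.mk.inj h
  have h1 : ∀ k, ξ (i.add k) = 0 := fun k => by
    induction k with
    | zero => exact h0.symm
    | succ k ih => exact (hξ k).trans (by rw [ih, map_zero])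
  refine (QuotientAddGroup.eq_zero_iff _).2 ⟨i.q, fun j hj => ?_⟩
  obtain ⟨k, rfl⟩ := Idx.exists_add hj
  exact h1 k

/-- The homomorphism from a direct limit to the group of germs of families. It detects when the
transition homomorphisms annihilate an element. -/
noncomputable def germ (t : ∀ i : Idx n, G i →+ G i.succ) :
    DirLim Idx.succ G t →+ (∀ j, G j) ⧸ eventuallyZero G :=
  DirLim.lift (fun i => homOfGraph _ (germGraph_total (t := t) i) (germGraph_single i))
    (fun i x => by
      obtain ⟨_, ξ, hξ, h⟩ := germGraph_total (t := t) i x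
      obtain ⟨rfl, -⟩ := Prod.mk.inj h
      rw [homOfGraph_eq (Γ := germGraph t i) (h := QuotientAddGroup.mk ξ) ⟨ξ, hξ, rfl⟩]
      refine homOfGraph_eq (Γ := germGraph t i.succ) ⟨ξ, fun k => ?_, ?_⟩
      · have : i.succ.add k = i.add (k + 1) := by ext <;> simp <;> omega
        rw [this]
        exact hξ (k + 1)
      · exact Prod.ext (hξ 0).symm rfl)

/-- An element of a term of a direct system represents zero only if it becomes zero after finitely
many transition homomorphisms. -/
theorem DirLim.dies {i : Idx n} {x : G i} (h : (of i x : DirLim Idx.succ G t) = 0) :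
    Dies t i x := by
  obtain ⟨_, ξ, hξ, h'⟩ := germGraph_total (t := t) i x
  obtain ⟨rfl, -⟩ := Prod.mk.inj h'
  have h1 : germ t (of i (ξ i)) = QuotientAddGroup.mk ξ := by
    rw [germ, lift_of]
    exact homOfGraph_eq ⟨ξ, hξ, rfl⟩
  rw [h, map_zero] at h1
  obtain ⟨N, hN⟩ := (QuotientAddGroup.eq_zero_iff _).1 h1.symm
  have h2 : ∀ k, Dies t (i.add k) (ξ (i.add k)) → Dies t i (ξ i) := fun k => by
    induction k with
    | zero => exact id
    | succ k ih =>
      intro hk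
      refine ih (Dies.step _ _ ?_)
      rw [← hξ k]
      exact hk
  refine h2 N ?_
  rw [hN _ (by simp)]
  exact Dies.zero _

/-- Induction over the transition homomorphisms that make an element zero. -/
theorem DirLim.induction_of_eq_zero {P : ∀ i, G i → Prop} (zero : ∀ i, P i 0)
    (step : ∀ i x, P i.succ (t i x) → P i x) {i : Idx n} {x : G i}
    (h : (of i x : DirLim Idx.succ G t) = 0) : P i x := by
  have hx := dies h
  clear h
  induction hx with
  | zero i => exact zero i
  | step i x _ ih => exact step i x ih

end DirLimElements

/-! ### Chain maps up to maps factoring through projectives -/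

section StableChainLift

variable {C : Type u} [Category.{v} C] [Abelian C]

theorem Stable.mk_eq {X Y : C} {f g : X ⟶ Y} :
    Stable.mk f = Stable.mk g ↔ f - g ∈ projHom X Y :=
  QuotientAddGroup.eq_iff_sub_mem

theorem comp_mem_projHom {X Y Z : C} (f : X ⟶ Y) {g : Y ⟶ Z} (hg : g ∈ projHom Y Z) :
    f ≫ g ∈ projHom X Z := by
  obtain ⟨Q, hQ, a, b, rfl⟩ := hg
  exact ⟨Q, hQ, f ≫ a, b, Category.assoc _ _ _⟩

theorem Stable.post_congr (X : C) {Y Z : C} {g g' : Y ⟶ Z} (h : Stable.mk g = Stable.mk g')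
    (x : Stable X Y) : Stable.post X g x = Stable.post X g' x := by
  obtain ⟨f, rfl⟩ := QuotientAddGroup.mk_surjective x
  rw [Stable.post_mk, Stable.post_mk, Stable.mk_eq, ← Preadditive.comp_sub]
  exact comp_mem_projHom f (Stable.mk_eq.1 h)

theorem Stable.post_comp {X Y Z W : C} (g : Y ⟶ Z) (h : Z ⟶ W) (x : Stable X Y) :
    Stable.post X h (Stable.post X g x) = Stable.post X (g ≫ h) x := by
  obtain ⟨f, rfl⟩ := QuotientAddGroup.mk_surjective x
  rw [Stable.post_mk, Stable.post_mk, Stable.post_mk, Category.assoc]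

variable {K L M N : CutResolution C}

/-- A morphism between syzygies that factors through a projective object induces morphisms between
the next syzygies that extend to the term of the resolution. -/
theorem exists_ι_comp_eq {p q : ℕ} {f : K.X p ⟶ L.X q} (hf : f ∈ projHom (K.X p) (L.X q))
    {f₀ : K.Q p ⟶ L.Q q} {f₁ : K.X (p + 1) ⟶ L.X (q + 1)} (h₀ : f₀ ≫ L.π q = K.π p ≫ f)
    (h₁ : f₁ ≫ L.ι q = K.ι p ≫ f₀) : ∃ e : K.Q p ⟶ L.X (q + 1), K.ι p ≫ e = f₁ := by
  obtain ⟨Q, _, a, b, rfl⟩ := hf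
  obtain ⟨c, rfl⟩ := L.exists_lift b
  obtain ⟨e, he⟩ := L.exists_ker (f₀ - K.π p ≫ a ≫ c) (by simp [h₀])
  refine ⟨e, ?_⟩
  rw [← cancel_mono (L.ι q), Category.assoc, he, h₁]
  simp [CutResolution.w_assoc]

/-- The components of a lift of a morphism between syzygies. -/
theorem exists_trans {p q : ℕ} (f : K.X p ⟶ L.X q) :
    ∃ (f₀ : K.Q p ⟶ L.Q q) (f₁ : K.X (p + 1) ⟶ L.X (q + 1)),
      f₀ ≫ L.π q = K.π p ≫ f ∧ f₁ ≫ L.ι q = K.ι p ≫ f₀ := by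
  obtain ⟨f₀, h₀⟩ := L.exists_lift (K.π p ≫ f)
  obtain ⟨f₁, h₁⟩ := L.exists_ker (K.ι p ≫ f₀) (by
    rw [Category.assoc, h₀, K.w_assoc, zero_comp])
  exact ⟨f₀, f₁, h₀, h₁⟩

theorem ChainLift.trans_X (F : ChainLift K L) (q : ℕ) :
    K.trans L q q (Stable.mk (F.X q)) = Stable.mk (F.X (q + 1)) :=
  CutResolution.trans_mk (F.Q q) (F.comm_π q) (F.comm_ι q)

/-- Two chain maps that agree stably in degree zero agree stably on all syzygies. -/
theorem ChainLift.mk_X_eq {F G : ChainLift K L} (h : Stable.mk (F.X 0) = Stable.mk (G.X 0))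
    (q : ℕ) : Stable.mk (F.X q) = Stable.mk (G.X q) := by
  induction q with
  | zero => exact h
  | succ q ih => rw [← F.trans_X, ← G.trans_X, ih]

/-- The identity chain map. -/
def ChainLift.id (K : CutResolution C) : ChainLift K K where
  X _ := 𝟙 _
  Q _ := 𝟙 _
  comm_π _ := by simp
  comm_ι _ := by simp

/-- The composition of chain maps. -/
def ChainLift.comp (F : ChainLift K L) (G : ChainLift L M) : ChainLift K M where
  X k := F.X k ≫ G.X k
  Q k := F.Q k ≫ G.Q k
  comm_π k := by rw [Category.assoc, G.comm_π, ← Category.assoc, F.comm_π, Category.assoc]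
  comm_ι k := by rw [Category.assoc, G.comm_ι, ← Category.assoc, F.comm_ι, Category.assoc]

/-- The sum of chain maps. -/
def ChainLift.add (F G : ChainLift K L) : ChainLift K L where
  X k := F.X k + G.X k
  Q k := F.Q k + G.Q k
  comm_π k := by simp [F.comm_π, G.comm_π]
  comm_ι k := by simp [F.comm_ι, G.comm_ι]

/-- The chain map between the resolutions of the first syzygies. -/
def ChainLift.tail (F : ChainLift K L) : ChainLift K.tail L.tail where
  X k := F.X (k + 1)
  Q k := F.Q (k + 1)
  comm_π k := F.comm_π (k + 1)
  comm_ι k := F.comm_ι (k + 1)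

variable (K)

theorem BC.map_of (F : ChainLift L M) {n : ℤ} (i : Idx n) (x : Stable (K.X i.p) (L.X i.q)) :
    BC.map K F n (BC.of K L i x) = BC.of K M i (Stable.post _ (F.X i.q) x) :=
  DirLim.lift_of (s := Idx.succ) (G := fun i : Idx n => Stable (K.X i.p) (L.X i.q))
    (t := fun i => K.trans L i.p i.q) _ _ i x

theorem BC.exists_of {n : ℤ} (x : BC K L n) :
    ∃ (i : Idx n) (f : K.X i.p ⟶ L.X i.q), x = BC.of K L i (Stable.mk f) := by
  obtain ⟨i, -, -, -, y, rfl⟩ := DirLim.exists_of x 0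
  obtain ⟨f, rfl⟩ := QuotientAddGroup.mk_surjective y
  exact ⟨i, f, rfl⟩

theorem BC.induction_of_eq_zero {n : ℤ} {P : ∀ i : Idx n, Stable (K.X i.p) (L.X i.q) → Prop}
    (zero : ∀ i, P i 0) (step : ∀ i x, P i.succ (K.trans L i.p i.q x) → P i x) {i : Idx n}
    {x : Stable (K.X i.p) (L.X i.q)} (h : BC.of K L i x = 0) : P i x :=
  DirLim.induction_of_eq_zero (G := fun i : Idx n => Stable (K.X i.p) (L.X i.q))
    (t := fun i => K.trans L i.p i.q) zero step h

theorem BC.map_congr {F G : ChainLift L M} (h : Stable.mk (F.X 0) = Stable.mk (G.X 0)) (n : ℤ) :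
    BC.map K F n = BC.map K G n :=
  DirLim.hom_ext fun i x => by
    rw [BC.map_of, BC.map_of, Stable.post_congr _ (ChainLift.mk_X_eq h i.q)]

theorem BC.map_id (n : ℤ) : BC.map K (ChainLift.id L) n = AddMonoidHom.id _ :=
  DirLim.hom_ext fun i x => by
    obtain ⟨f, rfl⟩ := QuotientAddGroup.mk_surjective x
    rw [BC.map_of, Stable.post_mk]
    exact congrArg (fun g => BC.of K L i (Stable.mk g)) (Category.comp_id f)

theorem BC.map_comp (F : ChainLift L M) (G : ChainLift M N) (n : ℤ) :
    BC.map K (F.comp G) n = (BC.map K G n).comp (BC.map K F n) :=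
  DirLim.hom_ext fun i x => by
    rw [AddMonoidHom.comp_apply, BC.map_of, BC.map_of, BC.map_of, Stable.post_comp]
    rfl

theorem BC.map_add (F G : ChainLift L M) (n : ℤ) :
    BC.map K (F.add G) n = BC.map K F n + BC.map K G n :=
  DirLim.hom_ext fun i x => by
    obtain ⟨f, rfl⟩ := QuotientAddGroup.mk_surjective x
    rw [AddMonoidHom.add_apply, BC.map_of, BC.map_of, BC.map_of, ← _root_.map_add,
      Stable.post_mk, Stable.post_mk, Stable.post_mk]
    exact congrArg (fun g => BC.of K M i (Stable.mk g)) (Preadditive.comp_add _ _ _ f _ _)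

end StableChainLift

/-! ### The connecting homomorphism of the naive construction -/

section Tau

variable {C : Type u} [Category.{v} C] [Abelian C] (K : CutResolution C) {B D : CutResolution C}

/-- The morphism from the `(k + 1)`-st syzygy of `D` to the `k`-th syzygy of `B` that belongs to
a chain map `D^{+1}_• ⟶ B_•`. -/
def ChainLift.hX (F : ChainLift D.tail B) (k : ℕ) : D.X (k + 1) ⟶ B.X k := F.X k

/-- The morphisms `h^*` between the syzygies form a chain map up to the signs `(-1) ^ q`. -/
theorem ResSeq.mk_star (T : ResSeq B D) {F : ChainLift D.tail B}
    (h : Stable.mk (T.star 0) = Stable.mk (F.hX 0)) (q : ℕ) :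
    Stable.mk (T.star q) = (q : ℤ).negOnePow • Stable.mk (F.hX q) := by
  have hid : ∀ q, tauLevel D T q q (Stable.mk (𝟙 _)) = Stable.mk (T.star q) := fun q => by
    change Stable.post _ (T.star q) (D.trans D q q (Stable.mk (𝟙 _))) = _
    rw [CutResolution.trans_mk (𝟙 _) (f₁ := 𝟙 _) (by simp) (by simp), Stable.post_mk,
      Category.id_comp]
  induction q with
  | zero => simpa using h
  | succ q ih =>
    have h1 := trans_tauLevel D T q q (Stable.mk (𝟙 _))
    rw [CutResolution.trans_mk (𝟙 _) (f₁ := 𝟙 _) (by simp) (by simp), hid, hid, ih,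
      map_zsmul_unit] at h1
    have h2 : D.trans B (q + 1) q (Stable.mk (F.hX q)) = Stable.mk (F.hX (q + 1)) :=
      CutResolution.trans_mk (F.Q q) (F.comm_π q) (F.comm_ι q)
    rw [h2] at h1
    push_cast
    rw [Int.negOnePow_succ, Units.neg_smul, h1, neg_neg]

theorem tauHom_of_tauLevel (T : ResSeq B D) {n : ℤ} (i : Idx n)
    (x : Stable (K.X i.p) (D.X i.q)) :
    tauHom K T n (BC.of K D i x) =
      BC.of K B i.up ((i.q : ℤ).negOnePow • tauLevel K T i.p i.q x) :=
  DirLim.lift_of (s := Idx.succ) (G := fun i : Idx n => Stable (K.X i.p) (D.X i.q))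
    (t := fun i => K.trans D i.p i.q) _ _ i x

/-- The connecting homomorphism of the naive construction is induced, without signs, by a single
chain map `D^{+1}_• ⟶ B_•`. -/
theorem tauHom_of (T : ResSeq B D) {F : ChainLift D.tail B}
    (h : Stable.mk (T.star 0) = Stable.mk (F.hX 0)) {n : ℤ} (i : Idx n)
    (x : Stable (K.X i.p) (D.X i.q)) :
    tauHom K T n (BC.of K D i x) =
      BC.of K B i.up (Stable.post _ (F.hX i.q) (K.trans D i.p i.q x)) := by
  rw [tauHom_of_tauLevel]
  change BC.of K B i.up ((i.q : ℤ).negOnePow •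
    Stable.post _ (T.star i.q) (K.trans D i.p i.q x)) = _
  congr 1
  obtain ⟨g, hg⟩ := QuotientAddGroup.mk_surjective (K.trans D i.p i.q x)
  rw [← hg, Stable.post_mk, Stable.post_mk]
  have h1 := T.mk_star h i.q
  rw [show (i.q : ℤ).negOnePow • Stable.mk (F.hX i.q) =
    Stable.mk ((i.q : ℤ).negOnePow • F.hX i.q) from rfl, Stable.mk_eq] at h1
  have h2 := comp_mem_projHom g h1
  rw [Preadditive.comp_sub, ← Stable.mk_eq, Linear.comp_units_smul] at h2
  change _ • Stable.mk (g ≫ T.star i.q) = _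
  rw [h2]
  change (i.q : ℤ).negOnePow • (i.q : ℤ).negOnePow • Stable.mk (g ≫ F.hX i.q) = _
  rw [smul_smul, Int.units_mul_self, one_smul]

theorem tauHom_natural (T : ResSeq B D) {F : ChainLift D.tail B}
    (h : Stable.mk (T.star 0) = Stable.mk (F.hX 0)) {B' D' : CutResolution C} (T' : ResSeq B' D')
    {F' : ChainLift D'.tail B'} (h' : Stable.mk (T'.star 0) = Stable.mk (F'.hX 0))
    (U : ChainLift B B') (V : ChainLift D D')
    (hUV : Stable.mk (F.hX 0 ≫ U.X 0) = Stable.mk (V.X 1 ≫ F'.hX 0)) (n : ℤ) :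
    (BC.map K U (n + 1)).comp (tauHom K T n) = (tauHom K T' n).comp (BC.map K V n) :=
  DirLim.hom_ext fun i x => by
    rw [AddMonoidHom.comp_apply, AddMonoidHom.comp_apply, tauHom_of K T h, BC.map_of, BC.map_of,
      tauHom_of K T' h', trans_post, Stable.post_comp, Stable.post_comp]
    congr 1
    exact Stable.post_congr _ (ChainLift.mk_X_eq (F := F.comp U) (G := V.tail.comp F') hUV i.q) _

end Tau

/-! ### Exactness of the naive construction -/

section NaiveExact

variable {C : Type u} [Category.{v} C] [Abelian C] (K : CutResolution C) {B D : CutResolution C}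
  (T : ResSeq B D)

instance (k : ℕ) : Mono (T.f.X k) := (T.exactX k).mono_f
instance (k : ℕ) : Epi (T.g.X k) := (T.exactX k).epi_g

theorem ResSeq.exists_lift (T : ResSeq B D) {Y : C} [Projective Y] {q : ℕ} (f : Y ⟶ D.X q) :
    ∃ g : Y ⟶ T.M.X q, g ≫ T.g.X q = f :=
  ⟨Projective.factorThru f (T.g.X q), Projective.factorThru_comp _ _⟩

theorem ResSeq.exists_ker (T : ResSeq B D) {Y : C} {q : ℕ} (f : Y ⟶ T.M.X q)
    (hf : f ≫ T.g.X q = 0) : ∃ g : Y ⟶ B.X q, g ≫ T.f.X q = f :=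
  ⟨(T.exactX q).exact.lift f hf, (T.exactX q).exact.lift_f f hf⟩

/-- The components of the connecting homomorphism on representatives. -/
theorem ResSeq.exists_tau {p q : ℕ} (f : K.X p ⟶ D.X q) :
    ∃ (f₀ : K.Q p ⟶ T.M.X q) (f₁ : K.X (p + 1) ⟶ B.X q),
      f₀ ≫ T.g.X q = K.π p ≫ f ∧ f₁ ≫ T.f.X q = K.ι p ≫ f₀ := by
  obtain ⟨f₀, h₀⟩ := T.exists_lift (K.π p ≫ f)
  obtain ⟨f₁, h₁⟩ := T.exists_ker (K.ι p ≫ f₀) (by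
    rw [Category.assoc, h₀, K.w_assoc, zero_comp])
  exact ⟨f₀, f₁, h₀, h₁⟩

theorem BC.map_g_map_f (n : ℤ) (x : BC K B n) : BC.map K T.g n (BC.map K T.f n x) = 0 := by
  obtain ⟨i, f, rfl⟩ := BC.exists_of K x
  rw [BC.map_of, BC.map_of, Stable.post_mk, Stable.post_mk, Category.assoc, T.wX, comp_zero]
  exact map_zero _

theorem BC.tauHom_map_g (n : ℤ) (x : BC K T.M n) : tauHom K T n (BC.map K T.g n x) = 0 := by
  obtain ⟨i, f, rfl⟩ := BC.exists_of K x
  rw [BC.map_of, Stable.post_mk, tauHom_of_tauLevel,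
    tauLevel_mk K T (K.π i.p ≫ f) (f₁ := 0) (Category.assoc _ _ _) (by simp [K.w_assoc])]
  change BC.of K B i.up (_ • (0 : Stable _ _)) = 0
  rw [smul_zero, map_zero]

theorem BC.map_f_tauHom (n : ℤ) (x : BC K D n) : BC.map K T.f (n + 1) (tauHom K T n x) = 0 := by
  obtain ⟨i, f, rfl⟩ := BC.exists_of K x
  obtain ⟨f₀, f₁, h₀, h₁⟩ := T.exists_tau K f
  rw [tauHom_of_tauLevel, tauLevel_mk K T f₀ h₀ h₁, BC.map_of, map_zsmul_unit, Stable.post_mk, h₁,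
    Stable.mk_eq_zero.2 ⟨K.Q i.p, inferInstance, K.ι i.p, f₀, rfl⟩, smul_zero, map_zero]

/-- Exactness at the middle term holds in every term of the direct system. -/
theorem Stable.exists_post_f {p q : ℕ} {x : Stable (K.X p) (T.M.X q)}
    (hx : Stable.post _ (T.g.X q) x = 0) :
    ∃ y : Stable (K.X p) (B.X q), Stable.post _ (T.f.X q) y = x := by
  obtain ⟨f, rfl⟩ := QuotientAddGroup.mk_surjective x
  rw [Stable.post_mk, Stable.mk_eq_zero] at hx
  obtain ⟨Q, _, a, b, hab⟩ := hx
  obtain ⟨b, rfl⟩ := T.exists_lift b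
  obtain ⟨c, hc⟩ := T.exists_ker (f - a ≫ b) (by
    rw [Preadditive.sub_comp, Category.assoc, hab, sub_self])
  refine ⟨Stable.mk c, ?_⟩
  rw [Stable.post_mk, Stable.mk_eq, hc, sub_sub_cancel_left, ← Preadditive.neg_comp]
  exact ⟨Q, inferInstance, -a, b, rfl⟩

theorem BC.exists_map_f {n : ℤ} {x : BC K T.M n} (hx : BC.map K T.g n x = 0) :
    ∃ y, BC.map K T.f n y = x := by
  obtain ⟨i, f, rfl⟩ := BC.exists_of K x
  rw [BC.map_of] at hx
  refine BC.induction_of_eq_zero K (P := fun i z => ∀ x, Stable.post _ (T.g.X i.q) x = z →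
    ∃ y, BC.map K T.f n y = BC.of K T.M i x) ?_ ?_ hx _ rfl
  · intro i x hx
    obtain ⟨y, rfl⟩ := Stable.exists_post_f K T hx
    exact ⟨BC.of K B i y, BC.map_of K T.f i y⟩
  · rintro i _ ih x rfl
    obtain ⟨y, hy⟩ := ih (K.trans T.M i.p i.q x) (trans_post K T.g i.p i.q x).symm
    exact ⟨y, hy.trans (BC.of_trans K T.M i x)⟩

/-- Exactness at the third term holds after passing to the next term of the direct system: there,
a morphism that factors through a projective object extends to the term of the resolution. -/
theorem Stable.exists_post_g {p q : ℕ} {x : Stable (K.X p) (D.X q)}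
    (hx : tauLevel K T p q x = 0) :
    ∃ y : Stable (K.X (p + 1)) (T.M.X (q + 1)),
      Stable.post _ (T.g.X (q + 1)) y = K.trans D p q x := by
  obtain ⟨f, rfl⟩ := QuotientAddGroup.mk_surjective x
  obtain ⟨f₀, f₁, h₀, h₁⟩ := T.exists_tau K f
  change tauLevel K T p q (Stable.mk f) = 0 at hx
  rw [tauLevel_mk K T f₀ h₀ h₁, Stable.mk_eq_zero] at hx
  obtain ⟨G₀, G₁, hG₀, hG₁⟩ := exists_trans f₁
  obtain ⟨e, rfl⟩ := exists_ι_comp_eq hx hG₀ hG₁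
  obtain ⟨F₀, z, hF₀, hz⟩ := T.exists_anticomm f₀ (K.ι p) f₁ h₁ G₀ (K.π (p + 1)) hG₀
  have hf : (F₀ ≫ T.g.Q q) ≫ D.π q = K.π p ≫ f := by
    rw [Category.assoc, T.g.comm_π, ← Category.assoc, hF₀, h₀]
  obtain ⟨f', hf'⟩ := D.exists_ker (K.ι p ≫ F₀ ≫ T.g.Q q) (by
    rw [Category.assoc, hf, ← Category.assoc, K.w, zero_comp])
  -- On the next syzygy `z` restricts to `-K.ι (p + 1) ≫ e ≫ T.f.X (q + 1)`, so that adding the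
  -- extension `e` makes it descend.
  obtain ⟨m, hm⟩ := K.exists_coker (z + e ≫ T.f.X (q + 1)) (by
    rw [← cancel_mono (T.M.ι q)]
    simp only [Preadditive.comp_add, Preadditive.add_comp, Category.assoc, hz, T.f.comm_ι,
      Preadditive.comp_sub, zero_comp, K.w_assoc]
    rw [← reassoc_of% hG₁]
    simp)
  refine ⟨Stable.mk m, ?_⟩
  change _ = K.trans D p q (Stable.mk f)
  rw [CutResolution.trans_mk _ hf hf', Stable.post_mk]
  congr 1
  rw [← cancel_epi (K.π (p + 1)), ← cancel_mono (D.ι q), reassoc_of% hm]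
  simp only [Category.assoc, hf', T.g.comm_ι, Preadditive.add_comp, reassoc_of% hz,
    Preadditive.sub_comp, T.wQ, comp_zero, sub_zero, add_zero, T.wX]

theorem BC.exists_map_g {n : ℤ} {x : BC K D n} (hx : tauHom K T n x = 0) :
    ∃ y, BC.map K T.g n y = x := by
  obtain ⟨i, f, rfl⟩ := BC.exists_of K x
  rw [tauHom_of_tauLevel, map_zsmul_unit, smul_eq_zero_iff_eq] at hx
  refine BC.induction_of_eq_zero K (P := fun j z => ∀ (i : Idx n) (_ : j = i.up)
    (x : Stable (K.X i.p) (D.X i.q)), HEq (tauLevel K T i.p i.q x) z →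
      ∃ y, BC.map K T.g n y = BC.of K D i x) ?_ ?_ hx i rfl _ HEq.rfl
  · rintro _ i rfl x hx
    obtain ⟨y, hy⟩ := Stable.exists_post_g K T (eq_of_heq hx)
    refine ⟨BC.of K T.M i.succ y, ?_⟩
    rw [BC.map_of, ← BC.of_trans K D i x]
    exact congrArg (BC.of K D i.succ) hy
  · rintro _ z ih i rfl x hx
    obtain rfl := eq_of_heq hx
    -- `τ` anticommutes with the transition homomorphisms before the sign is inserted.
    obtain ⟨y, hy⟩ := ih i.succ rfl (-K.trans D i.p i.q x) (heq_of_eq (by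
      rw [map_neg]; exact (trans_tauLevel K T i.p i.q x).symm))
    refine ⟨-y, ?_⟩
    rw [map_neg, hy, map_neg, neg_neg]
    exact BC.of_trans K D i x

/-- Exactness at the first term also holds after passing to the next term of the direct system. -/
theorem Stable.exists_tauLevel {p q : ℕ} {x : Stable (K.X p) (B.X q)}
    (hx : Stable.post _ (T.f.X q) x = 0) :
    ∃ y : Stable (K.X p) (D.X (q + 1)), tauLevel K T p (q + 1) y = K.trans B p q x := by
  obtain ⟨f, rfl⟩ := QuotientAddGroup.mk_surjective x
  obtain ⟨f₀, f₁, h₀, h₁⟩ := exists_trans f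
  rw [Stable.post_mk, Stable.mk_eq_zero] at hx
  obtain ⟨e, he⟩ := exists_ι_comp_eq hx (f₀ := f₀ ≫ T.f.Q q) (f₁ := f₁ ≫ T.f.X (q + 1))
    (by rw [Category.assoc, T.f.comm_π, reassoc_of% h₀])
    (by rw [Category.assoc, T.f.comm_ι, reassoc_of% h₁])
  obtain ⟨m, hm⟩ := K.exists_coker (e ≫ T.g.X (q + 1)) (by
    rw [reassoc_of% he, T.wX, comp_zero])
  refine ⟨Stable.mk m, ?_⟩
  rw [tauLevel_mk K T e hm.symm he.symm]
  exact (CutResolution.trans_mk f₀ h₀ h₁).symm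

theorem BC.exists_tauHom {n : ℤ} {x : BC K B (n + 1)} (hx : BC.map K T.f (n + 1) x = 0) :
    ∃ y, tauHom K T n y = x := by
  obtain ⟨i, f, rfl⟩ := BC.exists_of K x
  rw [BC.map_of] at hx
  refine BC.induction_of_eq_zero K (P := fun i z => ∀ x, Stable.post _ (T.f.X i.q) x = z →
    ∃ y, tauHom K T n y = BC.of K B i x) ?_ ?_ hx _ rfl
  · intro i x hx
    obtain ⟨y, hy⟩ := Stable.exists_tauLevel K T hx
    -- The preimage lives in the term with the same `p` and the next `q`.
    let j : Idx n := ⟨i.p, i.q + 1, by have := i.h; push_cast; omega⟩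
    refine ⟨BC.of K D j ((j.q : ℤ).negOnePow • y), ?_⟩
    rw [tauHom_of_tauLevel, map_zsmul_unit (tauLevel K T j.p j.q), smul_smul, Int.units_mul_self,
      one_smul, ← BC.of_trans K B i x]
    exact congrArg (BC.of K B i.succ) hy
  · rintro i _ ih x rfl
    obtain ⟨y, hy⟩ := ih (K.trans B i.p i.q x) (trans_post K T.f i.p i.q x).symm
    exact ⟨y, hy.trans (BC.of_trans K B i x)⟩

end NaiveExact

/-! ### The comparison of the resolution and the naive construction -/

section Beta

variable {C : Type u} [Category.{v} C] [Abelian C] (K L : CutResolution C) {M B D : CutResolution C}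

/-- The homomorphism from `Hom(X p, B)` to `Ext^p(A, B)` that sends a morphism to the class of its
composition with the epimorphism onto the syzygy `X p`. -/
def ExtGrp.ofHom (p : ℕ) (B : C) : (K.X p ⟶ B) →+ ExtGrp K p B :=
  AddMonoidHom.mk' (fun f => ExtGrp.mk ⟨K.π p ≫ f, cocycle_comp f⟩) (fun _ _ =>
    congrArg ExtGrp.mk (Subtype.ext (Preadditive.comp_add _ _ _ _ _ _)))

theorem ExtGrp.ofHom_surjective (p : ℕ) (B : C) : Function.Surjective (ExtGrp.ofHom K p B) := by
  intro x
  obtain ⟨f, rfl⟩ := QuotientAddGroup.mk_surjective x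
  obtain ⟨g, hg⟩ := exists_cocycle f
  exact ⟨g, congrArg ExtGrp.mk (Subtype.ext hg)⟩

theorem betaLevel_ofHom {p : ℕ} {B : C} (f : K.X p ⟶ B) :
    betaLevel K p B (ExtGrp.ofHom K p B f) = Stable.mk f :=
  betaLevel_mk rfl

theorem deltaRes_ofHom_eq_zero {p q : ℕ} {f : K.X p ⟶ L.X q}
    (hf : f ∈ projHom (K.X p) (L.X q)) : deltaRes K L p q (ExtGrp.ofHom K p _ f) = 0 := by
  obtain ⟨Q, _, a, b, rfl⟩ := hf
  obtain ⟨c, rfl⟩ := L.exists_lift b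
  refine (deltaRes_mk (K.π p ≫ a ≫ c) (F := 0) ?_ ?_).trans (map_zero (QuotientAddGroup.mk' _))
  · rw [Category.assoc, Category.assoc]
  · rw [K.d_π_assoc, zero_comp]
    exact zero_comp

/-- The homomorphism from `[X p, X q]` to the next term `Ext^{p + 1}(A, X (q + 1))` of the
resolution construction. It is well defined since the connecting homomorphism annihilates the
classes of the cocycles that factor through a projective object. -/
noncomputable def gammaLevel (p q : ℕ) :
    Stable (K.X p) (L.X q) →+ ExtGrp K (p + 1) (L.X (q + 1)) :=
  QuotientAddGroup.lift _ ((deltaRes K L p q).comp (ExtGrp.ofHom K p _))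
    fun _ hf => deltaRes_ofHom_eq_zero K L hf

theorem gammaLevel_betaLevel (p q : ℕ) (x : ExtGrp K p (L.X q)) :
    gammaLevel K L p q (betaLevel K p _ x) = deltaRes K L p q x := by
  obtain ⟨f, rfl⟩ := ExtGrp.ofHom_surjective K p _ x
  rw [betaLevel_ofHom]
  rfl

theorem betaLevel_surjective (p : ℕ) (B : C) : Function.Surjective (betaLevel K p B) := by
  intro x
  obtain ⟨f, rfl⟩ := QuotientAddGroup.mk_surjective x
  exact ⟨_, betaLevel_ofHom K f⟩

theorem betaLevel_gammaLevel (p q : ℕ) (x : Stable (K.X p) (L.X q)) :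
    betaLevel K (p + 1) _ (gammaLevel K L p q x) = K.trans L p q x := by
  obtain ⟨x, rfl⟩ := betaLevel_surjective K p _ x
  rw [gammaLevel_betaLevel, betaLevel_delta]

theorem gammaLevel_trans (p q : ℕ) (x : Stable (K.X p) (L.X q)) :
    gammaLevel K L (p + 1) (q + 1) (K.trans L p q x) =
      deltaRes K L (p + 1) (q + 1) (gammaLevel K L p q x) := by
  rw [← betaLevel_gammaLevel, gammaLevel_betaLevel]

/-- The inverse of `β^n`. -/
noncomputable def gammaHom (n : ℤ) : BC K L n →+ ExtRes K L n :=
  DirLim.lift (s := Idx.succ) (G := fun i : Idx n => Stable (K.X i.p) (L.X i.q))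
    (t := fun i => K.trans L i.p i.q)
    (fun i => (ExtRes.of K L i.succ).comp (gammaLevel K L i.p i.q)) (fun i x => by
      change ExtRes.of K L i.succ.succ (gammaLevel K L (i.p + 1) (i.q + 1) (K.trans L i.p i.q x)) =
        ExtRes.of K L i.succ (gammaLevel K L i.p i.q x)
      rw [gammaLevel_trans]
      exact ExtRes.of_delta K L i.succ _)

theorem gammaHom_of {n : ℤ} (i : Idx n) (x : Stable (K.X i.p) (L.X i.q)) :
    gammaHom K L n (BC.of K L i x) = ExtRes.of K L i.succ (gammaLevel K L i.p i.q x) :=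
  DirLim.lift_of (s := Idx.succ) (G := fun i : Idx n => Stable (K.X i.p) (L.X i.q))
    (t := fun i => K.trans L i.p i.q) _ _ i x

theorem betaHom_of {n : ℤ} (i : Idx n) (x : ExtGrp K i.p (L.X i.q)) :
    betaHom K L n (ExtRes.of K L i x) = BC.of K L i (betaLevel K i.p _ x) :=
  DirLim.lift_of (s := Idx.succ) (G := fun i : Idx n => ExtGrp K i.p (L.X i.q))
    (t := fun i => deltaRes K L i.p i.q) _ _ i x

theorem betaHom_bijective (n : ℤ) : Function.Bijective (betaHom K L n) := by
  refine Function.bijective_iff_has_inverse.2 ⟨gammaHom K L n, fun x => ?_, fun x => ?_⟩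
  · refine DFunLike.congr_fun (f := (gammaHom K L n).comp (betaHom K L n))
      (g := AddMonoidHom.id _) (DirLim.hom_ext fun i x => ?_) x
    change gammaHom K L n (betaHom K L n (ExtRes.of K L i x)) = ExtRes.of K L i x
    rw [betaHom_of, gammaHom_of, gammaLevel_betaLevel]
    exact ExtRes.of_delta K L i x
  · refine DFunLike.congr_fun (f := (betaHom K L n).comp (gammaHom K L n))
      (g := AddMonoidHom.id _) (DirLim.hom_ext fun i x => ?_) x
    change betaHom K L n (gammaHom K L n (BC.of K L i x)) = BC.of K L i x
    rw [gammaHom_of, betaHom_of, betaLevel_gammaLevel]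
    exact BC.of_trans K L i x

variable {L}

theorem betaHom_map (F : ChainLift L M) (n : ℤ) (x : ExtRes K L n) :
    betaHom K M n (ExtRes.map K F n x) = BC.map K F n (betaHom K L n x) := by
  refine DFunLike.congr_fun (f := (betaHom K M n).comp (ExtRes.map K F n))
    (g := (BC.map K F n).comp (betaHom K L n)) (DirLim.hom_ext fun i x => ?_) x
  change betaHom K M n (ExtRes.map K F n (ExtRes.of K L i x)) =
    BC.map K F n (betaHom K L n (ExtRes.of K L i x))
  obtain ⟨f, rfl⟩ := ExtGrp.ofHom_surjective K i.p _ x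
  have h : ExtRes.map K F n (ExtRes.of K L i (ExtGrp.ofHom K i.p _ f)) =
      ExtRes.of K M i (ExtGrp.map K i.p (F.X i.q) (ExtGrp.ofHom K i.p _ f)) :=
    DirLim.lift_of (s := Idx.succ) (G := fun i : Idx n => ExtGrp K i.p (L.X i.q))
      (t := fun i => deltaRes K L i.p i.q) _ _ i _
  rw [h, betaHom_of, betaHom_of, BC.map_of, betaLevel_ofHom, Stable.post_mk]
  congr 1
  exact betaLevel_mk (f := ⟨(K.π i.p ≫ f) ≫ F.X i.q, _⟩) (Category.assoc _ _ _).symm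

theorem betaHom_deltaHom (T : ResSeq B D) (n : ℤ) (x : ExtRes K D n) :
    betaHom K B (n + 1) (deltaHom K T n x) = tauHom K T n (betaHom K D n x) := by
  refine DFunLike.congr_fun (f := (betaHom K B (n + 1)).comp (deltaHom K T n))
    (g := (tauHom K T n).comp (betaHom K D n)) (DirLim.hom_ext fun i x => ?_) x
  change betaHom K B (n + 1) (deltaHom K T n (ExtRes.of K D i x)) =
    tauHom K T n (betaHom K D n (ExtRes.of K D i x))
  obtain ⟨f, rfl⟩ := ExtGrp.ofHom_surjective K i.p _ x
  have h : deltaHom K T n (ExtRes.of K D i (ExtGrp.ofHom K i.p _ f)) =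
      ExtRes.of K B i.up ((i.q : ℤ).negOnePow • deltaRow K T i.p i.q (ExtGrp.ofHom K i.p _ f)) :=
    DirLim.lift_of (s := Idx.succ) (G := fun i : Idx n => ExtGrp K i.p (D.X i.q))
      (t := fun i => deltaRes K D i.p i.q) _ _ i _
  obtain ⟨f₀, f₁, h₀, h₁⟩ := T.exists_tau K f
  have h' : deltaRow K T i.p i.q (ExtGrp.ofHom K i.p _ f) = ExtGrp.ofHom K (i.p + 1) _ f₁ :=
    deltaRow_mk K T f₀ h₀ (by
      change (K.π (i.p + 1) ≫ f₁) ≫ T.f.X i.q = _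
      rw [Category.assoc, h₁, CutResolution.d, Category.assoc])
  rw [h, betaHom_of, betaHom_of, betaLevel_ofHom, tauHom_of_tauLevel, tauLevel_mk K T f₀ h₀ h₁, h',
    map_zsmul_unit, betaLevel_ofHom]

end Beta

/-! ### The comparison with the hypercohomology construction -/

section Rho

variable {C : Type u} [Category.{v} C] [Abelian C] {K L M B D : CutResolution C}

theorem rhoHom_mk {n : ℤ} {φ : almostHom K L n} {i : Idx n} (hi : Even i.q) {y : BC K L n}
    (h : SyzygyRel φ.1 i y) : rhoHom K L n (VExt.mk φ) = y :=
  homOfGraph_eq ⟨φ, i, hi, y, h, rfl⟩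

theorem exists_even_syzygyRel {n : ℤ} (φ : almostHom K L n) :
    ∃ (i : Idx n) (y : BC K L n), Even i.q ∧ SyzygyRel φ.1 i y := by
  obtain ⟨N, hN⟩ := exists_isChainFrom φ.2
  obtain ⟨i, hi, hi', -⟩ := Idx.exists_even n N
  obtain ⟨y, hy⟩ := SyzygyRel.exists (hN i hi')
  exact ⟨i, y, hi, hy⟩

theorem SyzygyRel.map (F : ChainLift L M) {n : ℤ} {φ : Cochain K L n} {i : Idx n} {y : BC K L n}
    (h : SyzygyRel φ i y) : SyzygyRel (Cochain.map K F n φ) i (BC.map K F n y) := by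
  obtain ⟨h, g, hg, rfl⟩ := h
  refine ⟨fun j hj => by rw [hypD_map, h j hj, zero_comp], g ≫ F.X i.q, ?_, ?_⟩
  · change _ = (φ i ≫ F.Q i.q) ≫ M.π i.q
    rw [reassoc_of% hg, Category.assoc, F.comm_π]
  · rw [BC.map_of, Stable.post_mk]

theorem rhoHom_map (F : ChainLift L M) (n : ℤ) (x : VExt K L n) :
    rhoHom K M n (VExt.map K F n x) = BC.map K F n (rhoHom K L n x) := by
  obtain ⟨φ, rfl⟩ := QuotientAddGroup.mk_surjective x
  obtain ⟨i, y, hi, hy⟩ := exists_even_syzygyRel φ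
  rw [rhoHom_mk hi hy]
  exact rhoHom_mk (φ := ⟨_, Cochain.map_mem_almostHom K F φ.2⟩) hi (hy.map F)

/-- The connecting operator of the hypercohomology construction induces the connecting homomorphism
of the naive construction. Its component at an index with even `q` has the sign `(-1) ^ n`, which
cancels the sign of the differential of degree `n`. -/
theorem SyzygyRel.shift (T : ResSeq B D) {F : ChainLift D.tail B}
    (hF : Stable.mk (T.star 0) = Stable.mk (F.hX 0)) {n : ℤ} {φ : Cochain K D n} {i : Idx n}
    (hi : Even i.q) {y : BC K D n} (h : SyzygyRel φ i y) :
    SyzygyRel (shiftOp K F rfl φ) i.up (tauHom K T n y) := by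
  obtain ⟨h, g, hg, rfl⟩ := h
  obtain ⟨g₁, hg₁⟩ := (h.mono (j := i.succ) (by simp)).exists_syzygy
  have h0 : φ i.succ ≫ D.d i.q = n.negOnePow • K.d i.p ≫ φ i := isChainFrom_iff.1 h 0
  have ht : K.trans D i.p i.q (Stable.mk g) = n.negOnePow • Stable.mk g₁ := by
    refine CutResolution.trans_mk (φ i) hg.symm (f₁ := n.negOnePow • g₁) ?_
    rw [← cancel_epi (K.π (i.p + 1)), Linear.units_smul_comp, Linear.comp_units_smul,
      reassoc_of% hg₁]
    change n.negOnePow • φ i.succ ≫ D.d i.q = K.π (i.p + 1) ≫ K.ι i.p ≫ φ i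
    rw [h0, smul_smul, Int.units_mul_self, one_smul, CutResolution.d, Category.assoc]
  refine ⟨?_, n.negOnePow • g₁ ≫ F.hX i.q, ?_, ?_⟩
  · rintro ⟨p, q, hpq⟩ hj
    rw [hypD_shiftOp K F rfl rfl, shiftOp_apply, h _ (hj.trans (Nat.le_succ q)), zero_comp,
      smul_zero]
  · change _ = (((i.q : ℤ) + n).negOnePow • φ i.succ ≫ F.h i.q) ≫ B.π i.q
    have hs : ((i.q : ℤ) + n).negOnePow = n.negOnePow := by
      rw [Int.negOnePow_add, Int.negOnePow_even _ (by exact_mod_cast hi), one_mul]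
    have hc : F.h i.q ≫ B.π i.q = D.π (i.q + 1) ≫ F.hX i.q := F.comm_π i.q
    rw [hs, Linear.units_smul_comp, Linear.comp_units_smul, Category.assoc, hc,
      reassoc_of% hg₁]
  · rw [tauHom_of K T hF, ht, map_zsmul_unit]
    rfl

theorem rhoHom_shiftHom (T : ResSeq B D) {F : ChainLift D.tail B}
    (hF : Stable.mk (T.star 0) = Stable.mk (F.hX 0)) (n : ℤ) (x : VExt K D n) :
    rhoHom K B (n + 1) (shiftHom K F n x) = tauHom K T n (rhoHom K D n x) := by
  obtain ⟨φ, rfl⟩ := QuotientAddGroup.mk_surjective x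
  obtain ⟨i, y, hi, hy⟩ := exists_even_syzygyRel φ
  rw [rhoHom_mk hi hy]
  exact rhoHom_mk (φ := ⟨_, shiftOp_mem_almostHom K F φ.2⟩) (i := i.up) hi (hy.shift T hF hi)

end Rho

section Sigma

variable {C : Type u} [Category.{v} C] [Abelian C] (K L : CutResolution C)

theorem sigmaHom_of_even {n : ℤ} {i : Idx n} (hi : Even i.q) (x : ExtGrp K i.p (L.X i.q)) :
    sigmaHom K L n (ExtRes.of K L i x) = sigmaLevel K L i x := by
  refine (DirLim.lift_of (s := Idx.succ) (G := fun i : Idx n => ExtGrp K i.p (L.X i.q))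
    (t := fun i => deltaRes K L i.p i.q) _ _ i x).trans ?_
  rw [if_pos hi]

theorem rhoHom_sigmaHom (n : ℤ) (x : ExtRes K L n) :
    rhoHom K L n (sigmaHom K L n x) = betaHom K L n x := by
  obtain ⟨i, hi, -, -, x, rfl⟩ := DirLim.exists_of x 0
  change rhoHom K L n (sigmaHom K L n (ExtRes.of K L i x)) = betaHom K L n (ExtRes.of K L i x)
  obtain ⟨_, f, φ, hf, hφ, h0, h⟩ := sigmaGraph_total i x
  obtain ⟨rfl, -⟩ := Prod.mk.inj h
  obtain ⟨g, hg⟩ := exists_cocycle f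
  rw [sigmaHom_of_even K L hi, sigmaLevel_mk hf hφ h0, betaHom_of, betaLevel_mk hg]
  exact rhoHom_mk hi ⟨hφ, g, hg.trans hf.symm, rfl⟩

theorem sigmaHom_surjective (n : ℤ) : Function.Surjective (sigmaHom K L n) := by
  intro x
  obtain ⟨φ, rfl⟩ := QuotientAddGroup.mk_surjective x
  obtain ⟨i, -, hi, hφ, g, hg, -⟩ := exists_even_syzygyRel φ
  -- `ψ` is the chain map representing the image under `σ` of the cocycle induced by `φ`; the
  -- difference of `ψ` and `φ` lifts a coboundary, hence is nullhomotopic in high degrees.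
  obtain ⟨_, f, ψ, hf, hψ, h0, h⟩ := sigmaGraph_total i (ExtGrp.ofHom K i.p _ g)
  obtain ⟨hfg, -⟩ := Prod.mk.inj h
  refine ⟨ExtRes.of K L i (ExtGrp.mk f), ?_⟩
  rw [sigmaHom_of_even K L hi, sigmaLevel_mk hf hψ h0, ← sub_eq_zero]
  refine (VExt.mk_eq_zero (φ := ψ - φ)).2
    (mem_almostNull i (φ := ψ.1 - φ.1) (by rw [sub_eq_add_neg]; exact hψ.add hφ.neg) ?_)
  rw [Pi.sub_apply, Preadditive.sub_comp, hf, ← hg]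
  refine (ExtGrp.mk_eq_zero (f := f - ⟨_, cocycle_comp g⟩)).1 ?_
  exact sub_eq_zero.2 hfg.symm

theorem sigmaHom_bijective (n : ℤ) : Function.Bijective (sigmaHom K L n) := by
  refine ⟨Function.Injective.of_comp (f := rhoHom K L n) ?_, sigmaHom_surjective K L n⟩
  rw [show rhoHom K L n ∘ sigmaHom K L n = betaHom K L n from funext (rhoHom_sigmaHom K L n)]
  exact (betaHom_bijective K L n).1

theorem rhoHom_bijective (n : ℤ) : Function.Bijective (rhoHom K L n) := by
  refine (Function.Bijective.of_comp_iff _ (sigmaHom_bijective K L n)).1 ?_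
  rw [show rhoHom K L n ∘ sigmaHom K L n = betaHom K L n from funext (rhoHom_sigmaHom K L n)]
  exact betaHom_bijective K L n

end Sigma

/-! ### Transport of cohomological functors along isomorphisms -/

section Transport

variable {C : Type*} [Category* C] [Abelian C] {D : Type*} [Category* D] [Abelian D]

theorem exact_of_isIso_comm {X Y Z X' Y' Z' : D} {f : X ⟶ Y} {g : Y ⟶ Z} {f' : X' ⟶ Y'}
    {g' : Y' ⟶ Z'} (a : X ⟶ X') (b : Y ⟶ Y') (c : Z ⟶ Z') [IsIso a] [IsIso b] [IsIso c]
    (hf : f ≫ b = a ≫ f') (hg : g ≫ c = b ≫ g')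
    (h : ∃ w : f ≫ g = 0, (ShortComplex.mk f g w).Exact) :
    ∃ w : f' ≫ g' = 0, (ShortComplex.mk f' g' w).Exact := by
  obtain ⟨w, h⟩ := h
  have w' : f' ≫ g' = 0 := by
    rw [← cancel_epi a, ← Category.assoc, ← hf, Category.assoc, ← hg, ← Category.assoc, w,
      zero_comp, comp_zero]
  exact ⟨w', ShortComplex.exact_of_iso (ShortComplex.isoMk (S₁ := ShortComplex.mk f g w)
    (S₂ := ShortComplex.mk f' g' w') (asIso a) (asIso b) (asIso c) hf.symm hg.symm) h⟩

variable {T U : CohData C D} {ν : ∀ (n : ℤ) (X : C), T.obj n X ⟶ U.obj n X}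

theorem IsCohomologicalIso.symm (h : IsCohomologicalIso T U ν) :
    IsCohomologicalIso U T (fun n X => have := h.isIso n X; inv (ν n X)) where
  natural n X Y f := by
    have := h.isIso n X
    have := h.isIso n Y
    rw [IsIso.comp_inv_eq, Category.assoc, h.natural, IsIso.inv_hom_id_assoc]
  comm_δ n S hS := by
    have := h.isIso n S.X₃
    have := h.isIso (n + 1) S.X₁
    rw [IsIso.comp_inv_eq, Category.assoc, h.comm_δ, IsIso.inv_hom_id_assoc]
  isIso n X := by
    have := h.isIso n X
    infer_instance

theorem IsCohomologicalFunctor.of_iso (hT : IsCohomologicalFunctor T)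
    (h : IsCohomologicalIso T U ν) : IsCohomologicalFunctor U := by
  have := h.isIso
  refine ⟨fun n X => ?_, fun n X Y Z f g => ?_, fun n X Y f g => ?_, fun n S S' hS hS' φ => ?_,
    fun n S hS => ?_, fun n S hS => ?_, fun n S hS => ?_⟩
  · rw [← cancel_epi (ν n X), ← h.natural, hT.map_id, Category.id_comp, Category.comp_id]
  · rw [← cancel_epi (ν n X), ← h.natural, hT.map_comp, Category.assoc, h.natural,
      ← Category.assoc, h.natural, Category.assoc]
  · rw [← cancel_epi (ν n X), ← h.natural, hT.map_add, Preadditive.comp_add, ← h.natural,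
      ← h.natural, Preadditive.add_comp]
  · rw [← cancel_epi (ν n S.X₃), ← Category.assoc, ← h.comm_δ, Category.assoc, ← h.natural,
      ← Category.assoc, hT.δ_natural n hS hS' φ, Category.assoc, h.comm_δ, ← Category.assoc,
      h.natural, Category.assoc]
  · exact exact_of_isIso_comm _ _ _ (h.comm_δ n hS) (h.natural (n + 1) S.f) (hT.exact₁ n hS)
  · exact exact_of_isIso_comm _ _ _ (h.natural n S.f) (h.natural n S.g) (hT.exact₂ n hS)
  · exact exact_of_isIso_comm _ _ _ (h.natural n S.g) (h.comm_δ n hS) (hT.exact₃ n hS)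

theorem addCommGrp_exact {X Y Z : Type v} [AddCommGroup X] [AddCommGroup Y] [AddCommGroup Z]
    (f : X →+ Y) (g : Y →+ Z) (w : ∀ x, g (f x) = 0) (h : ∀ y, g y = 0 → ∃ x, f x = y) :
    ∃ w : AddCommGrpCat.ofHom f ≫ AddCommGrpCat.ofHom g = 0,
      (ShortComplex.mk _ _ w).Exact :=
  ⟨AddCommGrpCat.hom_ext (AddMonoidHom.ext w), (ShortComplex.ab_exact_iff _).2 h⟩

theorem addCommGrp_isIso {X Y : Type v} [AddCommGroup X] [AddCommGroup Y] {f : X →+ Y}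
    (h : Function.Bijective f) : IsIso (AddCommGrpCat.ofHom f) :=
  (ConcreteCategory.isIso_iff_bijective (AddCommGrpCat.ofHom f)).2 h

end Transport

/-! ### The naive construction is a cohomological functor -/

section NaiveFunctor

variable {C : Type u} [Category.{v} C] [Abelian C] (P : ∀ X : C, ProjectiveResolution X)

theorem resLift_X_zero {X Y : C} (f : X ⟶ Y) : (resLift P f).X 0 = f :=
  chainLift_X_zero (cut (P X)) (cut (P Y)) f

theorem starLift_hX_zero {S : ShortComplex C} (hS : S.ShortExact) :
    (starLift P hS).hX 0 =
      star hS ((cut (P S.X₃)).ι 0) ((cut (P S.X₃)).π 0) ((cut (P S.X₃)).w 0) :=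
  chainLift_X_zero _ _ _

/-- A morphism that lifts the identity along two short exact sequences is unique up to morphisms
that factor through the projective middle term of the first one. -/
theorem mk_eq_mk_of_star {S : ShortComplex C} (hS : S.ShortExact) {Q Y : C} [Projective Q]
    {ι : Y ⟶ Q} {π : Q ⟶ S.X₃} {a b : Y ⟶ S.X₁} {h k : Q ⟶ S.X₂} (hh : h ≫ S.g = π)
    (hk : k ≫ S.g = π) (ha : a ≫ S.f = ι ≫ h) (hb : b ≫ S.f = ι ≫ k) :
    Stable.mk a = Stable.mk b := by
  have := hS.mono_f
  obtain ⟨c, hc⟩ := hS.exact.lift' (h - k) (by rw [Preadditive.sub_comp, hh, hk, sub_self])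
  refine Stable.mk_eq.2 ⟨Q, inferInstance, ι, c, ?_⟩
  rw [← cancel_mono S.f, Category.assoc, hc, Preadditive.comp_sub, Preadditive.sub_comp, ha, hb]

/-- Morphisms that lift the identity are natural up to morphisms that factor through a projective
object. -/
theorem mk_comp_eq_mk_comp_of_star {S S' : ShortComplex C} (hS' : S'.ShortExact) (φ : S ⟶ S')
    {Q Y Q' Y' : C} [Projective Q] {ι : Y ⟶ Q} {π : Q ⟶ S.X₃} {ι' : Y' ⟶ Q'} {π' : Q' ⟶ S'.X₃}
    {a : Y ⟶ S.X₁} {h : Q ⟶ S.X₂} {b : Y' ⟶ S'.X₁} {k : Q' ⟶ S'.X₂} {x : Y ⟶ Y'} {y : Q ⟶ Q'}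
    (hh : h ≫ S.g = π) (ha : a ≫ S.f = ι ≫ h) (hk : k ≫ S'.g = π') (hb : b ≫ S'.f = ι' ≫ k)
    (hy : y ≫ π' = π ≫ φ.τ₃) (hx : x ≫ ι' = ι ≫ y) :
    Stable.mk (a ≫ φ.τ₁) = Stable.mk (x ≫ b) := by
  refine mk_eq_mk_of_star hS' (ι := ι) (h := h ≫ φ.τ₂) (k := y ≫ k) (π := π ≫ φ.τ₃) ?_ ?_ ?_ ?_
  · rw [Category.assoc, φ.comm₂₃, reassoc_of% hh]
  · rw [Category.assoc, hk, hy]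
  · rw [Category.assoc, φ.comm₁₂, reassoc_of% ha]
  · rw [Category.assoc, hb, reassoc_of% hx]

theorem Horseshoe.mk_star {S : ShortComplex C} (hS : S.ShortExact)
    (T : Horseshoe (P S.X₁) (P S.X₃)) :
    Stable.mk (T.toResSeq.star 0) = Stable.mk ((starLift P hS).hX 0) := by
  obtain ⟨h, hh, hs⟩ := T.star_spec 0
  obtain ⟨k, hk, hs'⟩ := star_spec hS ((cut (P S.X₃)).ι 0) ((cut (P S.X₃)).π 0)
    ((cut (P S.X₃)).w 0)
  rw [starLift_hX_zero]
  exact mk_eq_mk_of_star hS (h := h ≫ T.e.hom)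
    ((Category.assoc h T.e.hom S.g).trans ((congrArg (fun x => h ≫ x) T.e_g).trans hh)) hk
    ((congrArg (fun x => T.star 0 ≫ x) T.f_e.symm).trans ((reassoc_of% hs) T.e.hom)) hs'

variable (H : ∀ S : ShortComplex C, S.ShortExact → Horseshoe (P S.X₁) (P S.X₃)) (A : C)

theorem tauHom_resLift (n : ℤ) {S S' : ShortComplex C} (hS : S.ShortExact) (hS' : S'.ShortExact)
    (φ : S ⟶ S') :
    (BC.map (cut (P A)) (resLift P φ.τ₁) (n + 1)).comp
        (tauHom (cut (P A)) (H S hS).toResSeq n) =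
      (tauHom (cut (P A)) (H S' hS').toResSeq n).comp
        (BC.map (cut (P A)) (resLift P φ.τ₃) n) := by
  refine tauHom_natural _ _ ((H S hS).mk_star P hS) _ ((H S' hS').mk_star P hS') _ _ ?_ n
  obtain ⟨h, hh, hs⟩ := star_spec hS ((cut (P S.X₃)).ι 0) ((cut (P S.X₃)).π 0)
    ((cut (P S.X₃)).w 0)
  obtain ⟨k, hk, ks⟩ := star_spec hS' ((cut (P S'.X₃)).ι 0) ((cut (P S'.X₃)).π 0)
    ((cut (P S'.X₃)).w 0)
  rw [starLift_hX_zero, starLift_hX_zero, resLift_X_zero]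
  exact mk_comp_eq_mk_comp_of_star hS' φ (y := (resLift P φ.τ₃).Q 0) hh hs hk ks
    (((resLift P φ.τ₃).comm_π 0).trans
      (congrArg (fun x => (cut (P S.X₃)).π 0 ≫ x) (resLift_X_zero P φ.τ₃)))
    ((resLift P φ.τ₃).comm_ι 0)

/-- The resolution of the middle object of the short exact sequence that comes from the Horseshoe
Lemma and the chosen one are related by chain maps that are mutually inverse on the naive
construction. -/
theorem Horseshoe.exists_compare {S : ShortComplex C} (T : Horseshoe (P S.X₁) (P S.X₃))
    (K : CutResolution C) (n : ℤ) :
    ∃ e : BC K T.M n ≃+ BC K (cut (P S.X₂)) n,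
      (∀ x, BC.map K (resLift P S.f) n x = e (BC.map K T.f n x)) ∧
        (∀ x, BC.map K (resLift P S.g) n (e x) = BC.map K T.g n x) := by
  let u : ChainLift T.M (cut (P S.X₂)) := chainLift _ _ T.e.hom
  let w : ChainLift (cut (P S.X₂)) T.M := chainLift _ _ T.e.inv
  have hu : u.X 0 = T.e.hom := chainLift_X_zero _ _ _
  have hw : w.X 0 = T.e.inv := chainLift_X_zero _ _ _
  have huw : u.X 0 ≫ w.X 0 = 𝟙 _ := (congrArg₂ (· ≫ ·) hu hw).trans T.e.hom_inv_id
  have hwu : w.X 0 ≫ u.X 0 = 𝟙 _ := (congrArg₂ (· ≫ ·) hw hu).trans T.e.inv_hom_id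
  refine ⟨AddMonoidHom.toAddEquiv (BC.map K u n) (BC.map K w n) ?_ ?_, fun x => ?_, fun x => ?_⟩
  · rw [← BC.map_comp, BC.map_congr K (G := ChainLift.id _) (congrArg Stable.mk huw), BC.map_id]
  · rw [← BC.map_comp, BC.map_congr K (G := ChainLift.id _) (congrArg Stable.mk hwu), BC.map_id]
  · change _ = BC.map K u n _
    rw [← AddMonoidHom.comp_apply, ← BC.map_comp]
    exact DFunLike.congr_fun (BC.map_congr K (congrArg Stable.mk ((resLift_X_zero P S.f).trans
      (T.f_e.symm.trans (congrArg (fun x => T.f.X 0 ≫ x) hu.symm)))) n) x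
  · change BC.map K (resLift P S.g) n (BC.map K u n x) = _
    rw [← AddMonoidHom.comp_apply, ← BC.map_comp]
    exact DFunLike.congr_fun (BC.map_congr K (congrArg Stable.mk
      ((congrArg₂ (· ≫ ·) hu (resLift_X_zero P S.g)).trans T.e_g)) n) x

theorem naive_isCohomologicalFunctor : IsCohomologicalFunctor (naive P H A) where
  map_id n X := by
    refine AddCommGrpCat.hom_ext ?_
    change BC.map _ (resLift P (𝟙 X)) n = _
    rw [BC.map_congr (cut (P A)) (G := ChainLift.id _)
      (congrArg Stable.mk (resLift_X_zero P (𝟙 X))), BC.map_id]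
    rfl
  map_comp n X Y Z f g := by
    refine AddCommGrpCat.hom_ext ?_
    change BC.map _ (resLift P (f ≫ g)) n = (BC.map _ (resLift P g) n).comp (BC.map _ _ n)
    rw [← BC.map_comp]
    exact BC.map_congr _ (G := (resLift P f).comp (resLift P g)) (congrArg Stable.mk
      ((resLift_X_zero P (f ≫ g)).trans
      (congrArg₂ (· ≫ ·) (resLift_X_zero P f) (resLift_X_zero P g)).symm)) n
  map_add n X Y f g := by
    refine AddCommGrpCat.hom_ext ?_
    change BC.map _ (resLift P (f + g)) n = BC.map _ (resLift P f) n + BC.map _ (resLift P g) n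
    rw [← BC.map_add]
    exact BC.map_congr _ (G := (resLift P f).add (resLift P g)) (congrArg Stable.mk
      ((resLift_X_zero P (f + g)).trans
      (congrArg₂ (· + ·) (resLift_X_zero P f) (resLift_X_zero P g)).symm)) n
  δ_natural n S S' hS hS' φ :=
    AddCommGrpCat.hom_ext (tauHom_resLift P H A n hS hS' φ)
  exact₁ n S hS := by
    obtain ⟨e, hf, -⟩ := (H S hS).exists_compare P (cut (P A)) (n + 1)
    refine addCommGrp_exact _ _ (fun x => ?_) (fun x hx => ?_)
    · rw [hf, BC.map_f_tauHom, map_zero]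
    · refine BC.exists_tauHom (cut (P A)) (H S hS).toResSeq ?_
      rwa [hf, map_eq_zero_iff e e.injective] at hx
  exact₂ n S hS := by
    obtain ⟨e, hf, hg⟩ := (H S hS).exists_compare P (cut (P A)) n
    refine addCommGrp_exact _ _ (fun x => ?_) (fun x hx => ?_)
    · rw [hf, hg, BC.map_g_map_f]
    · obtain ⟨x, rfl⟩ := e.surjective x
      rw [hg] at hx
      obtain ⟨y, rfl⟩ := BC.exists_map_f (cut (P A)) (H S hS).toResSeq hx
      exact ⟨y, hf y⟩
  exact₃ n S hS := by
    obtain ⟨e, -, hg⟩ := (H S hS).exists_compare P (cut (P A)) n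
    refine addCommGrp_exact _ _ (fun x => ?_) (fun x hx => ?_)
    · obtain ⟨x, rfl⟩ := e.surjective x
      rw [hg, BC.tauHom_map_g]
    · obtain ⟨y, rfl⟩ := BC.exists_map_g (cut (P A)) (H S hS).toResSeq hx
      exact ⟨e y, hg y⟩

/-! ### The isomorphisms -/

theorem beta_isCohomologicalIso :
    IsCohomologicalIso (extRes P H A) (naive P H A) (beta P H A) where
  natural n _ _ f := AddCommGrpCat.hom_ext (AddMonoidHom.ext fun x =>
    betaHom_map (cut (P A)) (resLift P f) n x)
  comm_δ n S hS := AddCommGrpCat.hom_ext (AddMonoidHom.ext fun x =>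
    betaHom_deltaHom (cut (P A)) (H S hS).toResSeq n x)
  isIso n X := addCommGrp_isIso (betaHom_bijective (cut (P A)) (cut (P X)) n)

theorem rho_isCohomologicalIso :
    IsCohomologicalIso (hyper P A) (naive P H A) (rho P H A) where
  natural n _ _ f := AddCommGrpCat.hom_ext (AddMonoidHom.ext fun x =>
    rhoHom_map (resLift P f) n x)
  comm_δ n S hS := AddCommGrpCat.hom_ext (AddMonoidHom.ext fun x =>
    rhoHom_shiftHom (H S hS).toResSeq ((H S hS).mk_star P hS) n x)
  isIso n X := addCommGrp_isIso (rhoHom_bijective (cut (P A)) (cut (P X)) n)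

theorem sigma_rho (n : ℤ) (B : C) : sigma P H A n B ≫ rho P H A n B = beta P H A n B :=
  AddCommGrpCat.hom_ext (AddMonoidHom.ext fun x =>
    rhoHom_sigmaHom (cut (P A)) (cut (P B)) n x)

theorem sigma_isCohomologicalIso :
    IsCohomologicalIso (extRes P H A) (hyper P A) (sigma P H A) where
  natural n X Y f := by
    have := (rho_isCohomologicalIso P H A).isIso n Y
    rw [← cancel_mono (rho P H A n Y), Category.assoc, Category.assoc, sigma_rho,
      (rho_isCohomologicalIso P H A).natural, (beta_isCohomologicalIso P H A).natural,
      ← Category.assoc, sigma_rho]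
  comm_δ n S hS := by
    have := (rho_isCohomologicalIso P H A).isIso (n + 1) S.X₁
    rw [← cancel_mono (rho P H A (n + 1) S.X₁), Category.assoc, Category.assoc, sigma_rho,
      (rho_isCohomologicalIso P H A).comm_δ, (beta_isCohomologicalIso P H A).comm_δ,
      ← Category.assoc, sigma_rho]
  isIso n X := addCommGrp_isIso (sigmaHom_bijective (cut (P A)) (cut (P X)) n)

end NaiveFunctor

end CompleteExt

theorem mainTheorem5 {C : Type u} [Category.{v} C] [Abelian C] [EnoughProjectives C]
    (P : ∀ X : C, ProjectiveResolution X)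
    (H : ∀ S : ShortComplex C, S.ShortExact → CompleteExt.Horseshoe (P S.X₁) (P S.X₃)) (A : C) :
    CompleteExt.IsCohomologicalFunctor (CompleteExt.extRes P H A) ∧
    CompleteExt.IsCohomologicalFunctor (CompleteExt.hyper P A) ∧
    CompleteExt.IsCohomologicalFunctor (CompleteExt.naive P H A) ∧
    CompleteExt.IsCohomologicalIso (CompleteExt.extRes P H A) (CompleteExt.hyper P A)
      (CompleteExt.sigma P H A) ∧
    CompleteExt.IsCohomologicalIso (CompleteExt.extRes P H A) (CompleteExt.naive P H A)
      (CompleteExt.beta P H A) ∧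
    CompleteExt.IsCohomologicalIso (CompleteExt.hyper P A) (CompleteExt.naive P H A)
      (CompleteExt.rho P H A) ∧
    ∀ (n : ℤ) (B : C), ∃ _ : IsIso (CompleteExt.sigma P H A n B),
      CompleteExt.rho P H A n B =
        inv (CompleteExt.sigma P H A n B) ≫ CompleteExt.beta P H A n B := by
  have hN := CompleteExt.naive_isCohomologicalFunctor P H A
  have hσ := CompleteExt.sigma_isCohomologicalIso P H A
  have hβ := CompleteExt.beta_isCohomologicalIso P H A
  have hρ := CompleteExt.rho_isCohomologicalIso P H A
  refine ⟨hN.of_iso hβ.symm, hN.of_iso hρ.symm, hN, hσ, hβ, hρ, fun n B => ?_⟩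
  have := hσ.isIso n B
  exact ⟨this, by rw [IsIso.eq_inv_comp, CompleteExt.sigma_rho]⟩
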